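/- **Setting.** Let $X$ be a finite ground set and $f:2^X\to\mathbb R_{\ge 0}$ a (not necessarily monotone) submodular function; write $f(x\mid S)=f(S\cup\{x\})-f(S)$. Let $p\ge 1$ and let $\mathcal M^p$ be a $p$-matchoid, i.e. a finite collection of matroids $\mathcal M_\ell=(X_\ell,\mathcal I_\ell)$ with $X_\ell\subseteq X$ such that each $e\in X$ lies in at most $p$ of the sets $X_\ell$; $S\subseteq X$ is independent ($S\in\mathcal I$) iff $S\cap X_\ell\in\mathcal I_\ell$ for all $\ell$. Let $k$ be the maximum size of an independent set and $\mathit{OPT}$ an independent set of maximum value $f$. Let $\textsc{Offline}$ be a (possibly randomized) algorithm with approximation factor $\bar\gamma_{\rm off}\ge 1$: on every $B\subseteq X$ it returns an independent set $T\subseteq B$ with $\max\{f(U): U\subseteq B,\ U\in\mathcal I\}\le\bar\gamma_{\rm off}\,\mathbb E[f(T)]$. **Algorithm.** Given $\alpha$, $\beta_1,\dots,\beta_d$ and an integer $m$, put $S_0=S_0'=\emptyset$. In pass $i=1,\dots,d$ all of $X$ arrives, each element once, in an arbitrary fixed order (which may depend on $i$). Start with $S=S_{i-1}$ and an empty buffer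 $B$. Elements of the current solution $S$ are ordered by the time of their acceptance (those of $S_{i-1}$ keeping their earlier order), and $\nu(e,S)=f(e\mid\{t\in S: t \text{ accepted before } e\})$. For $x\in X$ let $C_x=C_x(S)$ consist of one element of $\arg\min_{t\in T_\ell}\nu(t,S)$ (ties broken arbitrarily), with $T_\ell=\{y\in S\cap X_\ell: (S\cap X_\ell)-y+x\in\mathcal I_\ell\}$, for each $\ell$ such that $x\in X_\ell$ and $(S\cap X_\ell)+x\notin\mathcal I_\ell$. Call $x$ *good for* $S$ if $$f(x\mid S)\ \ge\ \alpha+(1+\beta_i)\sum_{e\in C_x}\nu(e,S)$$ (never, if one of these $T_\ell$ is empty). When $x$ arrives, add it to $B$ if it is good for $S$. If then $|B|=m$ (and $B\neq\emptyset$), draw $y\in B$ uniformly at random, remove $y$ from $B$, replace $S$ by $S+y-C_y$, and delete from $B$ all elements that are not good for the new $S$. At the end of the pass put $S_i=S$, and let $S_i'$ be the better (with respect to $f$) of $S_{i-1}'$ and $\textsc{Offline}(B)$. After $d$ passes output $\bar S_d=\arg\max\{f(S_d),f(S'_d)\}$. **Theorem.** Let $\varepsilon>0$, let $d$ be the number of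 passes, $m=\lceil 4dk/\varepsilon^2\rceil$ and $\alpha=\varepsilon f(\mathit{OPT})/(2k)$ (with $\alpha=0$ if $k=0$). 1. For an arbitrary $p$-matchoid, run the algorithm with $\beta_1=1$ and $\beta_i=\frac{\gamma_{i-1}-1-p}{\gamma_{i-1}-1+p}$ for $i>1$, where $\gamma_1=4p$ and $\gamma_i=\frac{4p\,\gamma_{i-1}(\gamma_{i-1}-1)}{(\gamma_{i-1}-1+p)^2}$ for $i>1$. Then $\bar S_d$ is always independent, and for every $1\le i\le d$ $$(1-\varepsilon)f(\mathit{OPT})\le\Bigl(p+1+\frac{4p}{i}\Bigr)\mathbb E[f(S_i)]+\bar\gamma_{\rm off}\,\mathbb E[f(S_i')].$$ In particular, if $d\ge 4p/\varepsilon$, then $$(1-\varepsilon)f(\mathit{OPT})\le(p+1+\bar\gamma_{\rm off}+\varepsilon)\,\mathbb E[f(\bar S_d)].$$ 2. For a single matroid on $X$, run the algorithm with $\beta_i=1/i$ for all $i$. Then $\bar S_d$ is always independent, and if $d\ge 2/\varepsilon$, then $$(1-\varepsilon)f(\mathit{OPT})\le(2+\bar\gamma_{\rm off}+\varepsilon)\,\mathbb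 E[f(\bar S_d)].$$ -/

import Mathlib

noncomputable section

/-- A `p`-matchoid on the ground set `X`: a collection of matroids, each on a subset
`(matroid ℓ).E` of `X`, such that every element lies in at most `p` of these subsets. -/
structure Matchoid (X ι : Type*) (p : ℕ) where
  matroid : ι → Matroid X
  encard_le : ∀ e : X, {ℓ | e ∈ (matroid ℓ).E}.encard ≤ p

/-- Submodularity of a set function on the finite ground set `X`. -/
def IsSubmodular {X : Type*} [DecidableEq X] (f : Finset X → ℝ) : Prop :=
  ∀ A B : Finset X, f (A ∪ B) + f (A ∩ B) ≤ f A + f B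

/-- Expectation of a real random variable on a finite probability space. -/
def expect {Ω : Type*} [Fintype Ω] (P : PMF Ω) (g : Ω → ℝ) : ℝ :=
  ∑ ω, (P ω).toReal * g ω

/-- The incremental value `ν(e, S) = f(e | {t ∈ S : t ≺ e})`. A current solution is kept as a list
in the order `≺` in which its elements were accepted, so `{t ∈ S : t ≺ e}` is the part of the list
before `e`. -/
def incr {X : Type*} [DecidableEq X] (f : Finset X → ℝ) (e : X) (S : List X) : ℝ :=
  f (insert e (S.takeWhile (· ≠ e)).toFinset) - f (S.takeWhile (· ≠ e)).toFinset

namespace Matchoid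

section

variable {X ι : Type*} {p : ℕ} (M : Matchoid X ι p)

/-- A set is independent if its trace on each ground set is independent there. -/
def Indep (S : Finset X) : Prop :=
  ∀ ℓ, (M.matroid ℓ).Indep (↑S ∩ (M.matroid ℓ).E)

/-- A single matroid, as a `1`-matchoid. -/
def ofMatroid (N : Matroid X) : Matchoid X Unit 1 where
  matroid := fun _ => N
  encard_le := fun _ => by
    refine (Set.encard_le_encard (Set.subset_univ _)).trans ?_
    simp

/-- `k` is the rank: the maximum size of an independent set. -/
def IsRank (k : ℕ) : Prop :=
  IsGreatest {n | ∃ S : Finset X, M.Indep S ∧ S.card = n} k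

/-- `O` is an optimal solution of the problem of maximizing `f` over the independent sets. -/
def IsOpt (f : Finset X → ℝ) (O : Finset X) : Prop :=
  M.Indep O ∧ ∀ T, M.Indep T → f T ≤ f O

/-- A (possibly randomized) offline algorithm, which returns on every set `B` of elements an
independent subset of `B`, is a `γ`-approximation (in expectation) for maximizing `f` over the
independent subsets of `B`. -/
def IsOfflineApprox [Fintype X] (f : Finset X → ℝ) (γ : ℝ)
    (off : Finset X → PMF (Finset X)) : Prop :=
  ∀ B : Finset X, (∀ T ∈ (off B).support, T ⊆ B ∧ M.Indep T) ∧
    ∀ T ⊆ B, M.Indep T → f T ≤ γ * expect (off B) f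

variable [DecidableEq X]

/-- The set `S_ℓ = S ∩ X_ℓ`. -/
def trace (ℓ : ι) (S : List X) : Set X :=
  {y | y ∈ S} ∩ (M.matroid ℓ).E

/-- `x ∈ X_ℓ` and `S_ℓ + x ∉ 𝓘_ℓ`. -/
def Conflict (ℓ : ι) (x : X) (S : List X) : Prop :=
  x ∈ (M.matroid ℓ).E ∧ ¬ (M.matroid ℓ).Indep (insert x (M.trace ℓ S))

/-- `T_ℓ = {y ∈ S_ℓ : S_ℓ - y + x ∈ 𝓘_ℓ}`. -/
def swapSet (ℓ : ι) (x : X) (S : List X) : Set X :=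
  {y | y ∈ M.trace ℓ S ∧ (M.matroid ℓ).Indep (insert x (M.trace ℓ S \ {y}))}

/-- `pick ℓ x S` is a choice (with any tie-breaking) of `argmin_{t ∈ T_ℓ} ν(t, S)`. -/
def IsArgminRule (f : Finset X → ℝ) (pick : ι → X → List X → X) : Prop :=
  ∀ ℓ x S, (M.swapSet ℓ x S).Nonempty →
    pick ℓ x S ∈ M.swapSet ℓ x S ∧
      ∀ t ∈ M.swapSet ℓ x S, incr f (pick ℓ x S) S ≤ incr f t S

theorem exists_isArgminRule (f : Finset X → ℝ) : ∃ pick, M.IsArgminRule f pick := by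
  have h : ∀ ℓ x S, ∃ y, (M.swapSet ℓ x S).Nonempty →
      y ∈ M.swapSet ℓ x S ∧ ∀ t ∈ M.swapSet ℓ x S, incr f y S ≤ incr f t S := by
    intro ℓ x S
    by_cases hne : (M.swapSet ℓ x S).Nonempty
    · have hfin : (M.swapSet ℓ x S).Finite :=
        (List.finite_toSet S).subset fun y hy => hy.1.1
      obtain ⟨y, hy, hmin⟩ := Set.exists_min_image _ (fun t => incr f t S) hfin hne
      exact ⟨y, fun _ => ⟨hy, hmin⟩⟩
    · exact ⟨x, fun h => absurd h hne⟩
  choose pick hpick using h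
  exact ⟨pick, hpick⟩

variable [Fintype ι]

open Classical in
/-- The procedure `Exchange(x, S)`: the set `C_x`. -/
def exchange (pick : ι → X → List X → X) (x : X) (S : List X) : Finset X :=
  (Finset.univ.filter fun ℓ => M.Conflict ℓ x S).image fun ℓ => pick ℓ x S

/-- The test `f(x | S) ≥ α + (1 + β) ∑_{e ∈ C_x} ν(e, S)`. It fails when some `T_ℓ` over which a
minimum is to be taken is empty (a minimum over the empty set being `∞`); for independent `S` this
happens only if `x` is a loop of some matroid. -/
def Good (f : Finset X → ℝ) (pick : ι → X → List X → X) (α β : ℝ) (S : List X) (x : X) : Prop :=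
  (∀ ℓ, M.Conflict ℓ x S → (M.swapSet ℓ x S).Nonempty) ∧
    α + (1 + β) * ∑ e ∈ M.exchange pick x S, incr f e S ≤ f (insert x S.toFinset) - f S.toFinset

/-- `S + x - C_x`, the new element being last in the order of acceptance. -/
def accept (pick : ι → X → List X → X) (S : List X) (x : X) : List X :=
  (S.filter fun y => y ∉ M.exchange pick x S) ++ [x]

open Classical in
/-- The body of the loop of `RandomizedLocalSearch` for the arriving element `x`; the state is the
pair of the current solution `S` and the buffer `B`. -/
def step (f : Finset X → ℝ) (pick : ι → X → List X → X) (α β : ℝ) (m : ℕ) (x : X)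
    (s : List X × Finset X) : PMF (List X × Finset X) :=
  let S := s.1
  let B := if M.Good f pick α β S x then insert x s.2 else s.2
  if h : B.Nonempty ∧ B.card = m then
    (PMF.uniformOfFinset B h.1).bind fun y =>
      let S₁ := M.accept pick S y
      PMF.pure (S₁, (B.erase y).filter fun x' => M.Good f pick α β S₁ x')
  else PMF.pure (S, B)

/-- The loop of `RandomizedLocalSearch` over the elements of a stream. -/
def runStream (f : Finset X → ℝ) (pick : ι → X → List X → X) (α β : ℝ) (m : ℕ) :
    List X → List X × Finset X → PMF (List X × Finset X)
  | [], s => PMF.pure s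
  | x :: xs, s => (M.step f pick α β m x s).bind (runStream f pick α β m xs)

/-- The procedure `RandomizedLocalSearch(S_init, α, β, m)` on a given stream: it returns the
solution `S` and the result `S'` of the offline algorithm on the final buffer. -/
def randomizedLocalSearch (f : Finset X → ℝ) (pick : ι → X → List X → X)
    (off : Finset X → PMF (Finset X)) (stream : List X) (Sinit : List X) (α β : ℝ) (m : ℕ) :
    PMF (List X × Finset X) :=
  (M.runStream f pick α β m stream (Sinit, ∅)).bind fun s => (off s.2).map fun S' => (s.1, S')

/-- The joint law of `(S_i, S'_i)` in `MultipassRandomizedLocalSearch`, where `stream i` is the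
order of arrival in pass `i` and `β i` is the parameter of pass `i`, for `i = 1, 2, …`. -/
def multipass (f : Finset X → ℝ) (pick : ι → X → List X → X)
    (off : Finset X → PMF (Finset X)) (stream : ℕ → List X) (α : ℝ) (β : ℕ → ℝ) (m : ℕ) :
    ℕ → PMF (List X × Finset X)
  | 0 => PMF.pure ([], ∅)
  | i + 1 => (multipass f pick off stream α β m i).bind fun s =>
      (M.randomizedLocalSearch f pick off (stream (i + 1)) s.1 α (β (i + 1)) m).map fun t =>
        (t.1, if f s.2 ≤ f t.2 then t.2 else s.2)

/-- The law of the solution `S_i` (as a set). -/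
def solS (f : Finset X → ℝ) (pick : ι → X → List X → X)
    (off : Finset X → PMF (Finset X)) (stream : ℕ → List X) (α : ℝ) (β : ℕ → ℝ) (m i : ℕ) :
    PMF (Finset X) :=
  (M.multipass f pick off stream α β m i).map fun s => s.1.toFinset

/-- The law of the solution `S'_i`. -/
def solS' (f : Finset X → ℝ) (pick : ι → X → List X → X)
    (off : Finset X → PMF (Finset X)) (stream : ℕ → List X) (α : ℝ) (β : ℕ → ℝ) (m i : ℕ) :
    PMF (Finset X) :=
  (M.multipass f pick off stream α β m i).map fun s => s.2

/-- The law of the output `S̄_d = argmax {f(S_d), f(S'_d)}` after `d` passes. -/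
def output (f : Finset X → ℝ) (pick : ι → X → List X → X)
    (off : Finset X → PMF (Finset X)) (stream : ℕ → List X) (α : ℝ) (β : ℕ → ℝ) (m d : ℕ) :
    PMF (Finset X) :=
  (M.multipass f pick off stream α β m d).map fun s =>
    if f s.2 ≤ f s.1.toFinset then s.1.toFinset else s.2

end

end Matchoid

/-- The sequence `γ_1 = 4p`, `γ_i = 4p γ_{i-1} (γ_{i-1} - 1) / (γ_{i-1} - 1 + p)²` for `i > 1`
(the value at `0` is irrelevant). -/
def gammaSeq (p : ℕ) : ℕ → ℝ
  | 0 => 0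
  | 1 => 4 * p
  | i + 2 => 4 * p * (gammaSeq p (i + 1) * (gammaSeq p (i + 1) - 1)) /
      (gammaSeq p (i + 1) - 1 + p) ^ 2

/-- The sequence `β_1 = 1`, `β_i = (γ_{i-1} - 1 - p) / (γ_{i-1} - 1 + p)` for `i > 1`. -/
def betaSeq (p i : ℕ) : ℝ :=
  if i ≤ 1 then 1
  else (gammaSeq p (i - 1) - 1 - p) / (gammaSeq p (i - 1) - 1 + p)

/-- The buffer size `4 d k / ε²`, rounded up to an integer. -/
def bufferSize (d k : ℕ) (ε : ℝ) : ℕ := ⌈4 * d * k / ε ^ 2⌉₊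

end

/-! Fix one pass started from a solution of value v₀. Let A be the set of elements held at any time
of the pass and E the total incremental value of evicted elements, measured at eviction. An
acceptance loses at most ∑ν over C_x and gains at least α + (1+β)∑ν, so v₀ + βE ≤ f(S), while f(A) ≤
f(S) + E.

An element x of an independent set O that is neither in A nor in the buffer failed the test at some
moment. Its marginal is then at most α + (1+β)∑_ℓ w_ℓ, where x lies in the M_ℓ-span of the elements
of value at least w_ℓ. This spanning property survives later exchanges
(`level_subset_closure_accept`): an element evicted for the sake of M_ℓ is spanned by the newcomer
and by swap candidates that are at least as heavy, and an element evicted for another matroid is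
kept in a list of sinks for M_ℓ. So for each threshold θ the charges at least θ to M_ℓ number at
most the entries at least θ, by rank. Integrating over θ bounds all charges by p f(S) + (p-1)E,
since an evicted element is a sink in at most p-1 matroids. `Certificate.bound` combines these
estimates into an inequality for f(O ∪ A), with an error f(O ∩ B) that the offline algorithm covers.

Randomness is needed only to bound f(O ∪ A) from below. An acceptance is uniform over m candidates
and raises f by at least α, so a potential argument shows that in each pass an element is newly
touched with probability at most f(OPT)/(αm). Over at most d passes this is at most ε/2, and the
sampling lemma `expect_ge` yields E f(OPT ∪ A) ≥ (1-ε/2) f(OPT).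

The resulting inequality links consecutive passes. The β_i minimise the factor it propagates, giving
the recursion for γ_i, which is at most p+1+4p/i and equals 2+2/i when p = 1. -/

noncomputable section

set_option linter.unusedSectionVars false

/-! ### Submodular functions and random sets. -/

namespace IsSubmodular

variable {X : Type*} [DecidableEq X] {f : Finset X → ℝ}

theorem marginal_anti (hf : IsSubmodular f) {A B : Finset X} (h : A ⊆ B) {x : X} (hx : x ∉ B) :
    f (insert x B) - f B ≤ f (insert x A) - f A := by
  have h1 := hf (insert x A) B
  have e1 : insert x A ∪ B = insert x B := by
    rw [Finset.insert_union, Finset.union_eq_right.2 h]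
  have e2 : insert x A ∩ B = A := by
    rw [Finset.insert_inter_of_notMem hx, Finset.inter_eq_left.2 h]
  rw [e1, e2] at h1
  linarith

/-- The marginals are taken at the small set A although R is added to a larger D. This lets the
rejection bounds, which refer to A, be used after the buffered part of O has been added. -/
theorem union_le_add_sum (hf : IsSubmodular f) (A R : Finset X) (hR : ∀ x ∈ R, x ∉ A) :
    ∀ D, A ⊆ D → (∀ x ∈ R, x ∉ D) →
      f (D ∪ R) ≤ f D + ∑ x ∈ R, (f (insert x A) - f A) := by
  induction R using Finset.induction_on with
  | empty => intro D _ _; simp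
  | insert a R ha ih =>
    intro D hAD hD
    rw [Finset.sum_insert ha]
    have h1 := ih (fun x hx => hR x (Finset.mem_insert_of_mem hx)) D hAD
      (fun x hx => hD x (Finset.mem_insert_of_mem hx))
    have h2 : a ∉ D ∪ R := by
      simp [ha, hD a (Finset.mem_insert_self a R)]
    have h3 := hf.marginal_anti (hAD.trans Finset.subset_union_left) h2
    rw [Finset.union_insert]
    linarith

/-- A random set containing every element with probability at most `q` loses at most a `q`-fraction
of the value of a nonnegative submodular function at the empty set. -/
theorem expect_ge (hf : IsSubmodular f) (h0 : ∀ S, 0 ≤ f S) [Fintype X] (P : PMF (Finset X))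
    (q : ℝ) (hq : 0 ≤ q) (hP : ∀ x, expect P (fun S => if x ∈ S then 1 else 0) ≤ q) :
    (1 - q) * f ∅ ≤ expect P f := by
  set π : X → ℝ := fun x => expect P (fun S => if x ∈ S then 1 else 0) with hπ
  have hπ0 : ∀ x, 0 ≤ π x := fun x => Finset.sum_nonneg fun S _ =>
    mul_nonneg ENNReal.toReal_nonneg (by dsimp only; split_ifs <;> norm_num)
  -- Elements are added in order of decreasing probability and c records the telescoping marginals.
  -- The second clause is Abel summation, with r any lower bound for the probabilities on T.
  -- Nonnegativity of f allows r to be lowered at each step and finally to be set to 0.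
  have key : ∀ T : Finset X, ∃ c : X → ℝ,
      (∀ R ⊆ T, f ∅ + ∑ x ∈ R, c x ≤ f R) ∧
      ∀ r, 0 ≤ r → r ≤ q → (∀ x ∈ T, r ≤ π x) →
        r * f T - q * f ∅ ≤ ∑ x ∈ T, π x * c x := by
    intro T
    induction T using Finset.induction_on_min_value π with
    | empty =>
      refine ⟨fun _ => 0, ?_, ?_⟩
      · intro R hR
        simp [Finset.subset_empty.1 hR]
      · intro r hr hrq _
        have := mul_le_mul_of_nonneg_right hrq (h0 ∅)
        simp
        linarith
    | insert a T ha hmin ih =>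
      obtain ⟨c, hc1, hc2⟩ := ih
      refine ⟨fun x => if x = a then f (insert a T) - f T else c x, ?_, ?_⟩
      · intro R hR
        have hne : ∀ R' ⊆ T, ∑ x ∈ R', (if x = a then f (insert a T) - f T else c x)
            = ∑ x ∈ R', c x := fun R' hR' => Finset.sum_congr rfl fun x hx => by
          rw [if_neg]; rintro rfl; exact ha (hR' hx)
        by_cases haR : a ∈ R
        · have hsub : R.erase a ⊆ T := by
            intro x hx
            have := hR (Finset.mem_of_mem_erase hx)
            exact (Finset.mem_insert.1 this).resolve_left (Finset.ne_of_mem_erase hx)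
          rw [← Finset.add_sum_erase _ _ haR, hne _ hsub]
          have h1 := hc1 _ hsub
          have h2 := hf.marginal_anti hsub ha
          rw [Finset.insert_erase haR] at h2
          simp only [if_true]
          linarith
        · have hsub : R ⊆ T := (Finset.subset_insert_iff_of_notMem haR).1 hR
          rw [hne R hsub]
          exact hc1 R hsub
      · intro r hr hrq hrT
        rw [Finset.sum_insert ha]
        have e : ∑ x ∈ T, π x * (if x = a then f (insert a T) - f T else c x)
            = ∑ x ∈ T, π x * c x := Finset.sum_congr rfl fun x hx => by
          rw [if_neg]; rintro rfl; exact ha hx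
        rw [e]
        have h1 := hc2 (π a) (hπ0 a) (hP a) hmin
        have h2 := mul_le_mul_of_nonneg_right (hrT a (Finset.mem_insert_self a T))
          (h0 (insert a T))
        simp only [if_true]
        linarith
  obtain ⟨c, hc1, hc2⟩ := key Finset.univ
  have h1 := hc2 0 le_rfl hq (fun x _ => hπ0 x)
  have hsum : ∑ S, (P S).toReal = 1 := by
    rw [← ENNReal.toReal_sum (fun S _ => P.apply_ne_top S), ← tsum_fintype (L := .unconditional _),
      P.tsum_coe]
    simp
  have h2 : f ∅ + ∑ x, π x * c x ≤ expect P f := by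
    have e : ∑ x, π x * c x = ∑ S, (P S).toReal * ∑ x ∈ S, c x := by
      simp only [hπ, expect, Finset.sum_mul, Finset.mul_sum]
      rw [Finset.sum_comm]
      refine Finset.sum_congr rfl fun S _ => ?_
      rw [← Finset.sum_subset (Finset.subset_univ S)]
      · refine Finset.sum_congr rfl fun x hx => by simp [hx]
      · intro x _ hx; simp [hx]
    have e0 : f ∅ = ∑ S, (P S).toReal * f ∅ := by rw [← Finset.sum_mul, hsum, one_mul]
    rw [e, e0, ← Finset.sum_add_distrib]
    refine Finset.sum_le_sum fun S _ => ?_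
    rw [← mul_add]
    exact mul_le_mul_of_nonneg_left (hc1 S (Finset.subset_univ S)) ENNReal.toReal_nonneg
  linarith

end IsSubmodular

/-! ### Summation by thresholds. -/

open MeasureTheory in
theorem lintegral_length_filter_le (L : List ℝ) :
    ∫⁻ θ in Set.Ioi (0 : ℝ), ((L.filter fun v => θ ≤ v).length : ENNReal)
      = (L.map ENNReal.ofReal).sum := by
  induction L with
  | nil => simp
  | cons a L ih =>
    have e : ∀ θ : ℝ, (((a :: L).filter fun v => θ ≤ v).length : ENNReal)
        = (Set.Iic a).indicator 1 θ + ((L.filter fun v => θ ≤ v).length : ENNReal) := by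
      intro θ
      by_cases h : θ ≤ a
      · simp [h, add_comm]
      · simp [h]
    simp_rw [e]
    rw [lintegral_add_left (measurable_one.indicator measurableSet_Iic), ih,
      lintegral_indicator_one measurableSet_Iic, Measure.restrict_apply measurableSet_Iic,
      Set.inter_comm, Set.Ioi_inter_Iic, Real.volume_Ioc, sub_zero]
    simp

/-- Comparison of sums by thresholds. -/
theorem sum_le_sum_of_card_threshold_le {α β : Type*} (R : Finset α) (w : α → ℝ)
    (L : List (β × ℝ)) (hL : ∀ e ∈ L, 0 ≤ e.2)
    (h : ∀ θ, 0 < θ → (R.filter fun x => θ ≤ w x).card ≤ (L.filter fun e => θ ≤ e.2).length) :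
    ∑ x ∈ R, w x ≤ (L.map Prod.snd).sum := by
  -- Layer-cake formula: both sums are integrals over θ > 0 of the counts compared in `h`.
  have h1 : ((R.toList.map w).map ENNReal.ofReal).sum
      ≤ ((L.map Prod.snd).map ENNReal.ofReal).sum := by
    rw [← lintegral_length_filter_le, ← lintegral_length_filter_le]
    refine MeasureTheory.setLIntegral_mono' measurableSet_Ioi fun θ hθ => ?_
    have h2 := h θ hθ
    rw [List.filter_map, List.filter_map, List.length_map, List.length_map]
    have e : (R.filter fun x => θ ≤ w x).card
        = (R.toList.filter fun x => θ ≤ w x).length := by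
      rw [Finset.card_def, Finset.filter_val, ← Finset.coe_toList R, Multiset.filter_coe,
        Multiset.coe_card]
    rw [e] at h2
    exact_mod_cast h2
  -- No sign is assumed for w; truncating its negative values at 0 can only increase the sum.
  have h2 : ENNReal.ofReal (∑ x ∈ R, w x) ≤ ((R.toList.map w).map ENNReal.ofReal).sum := by
    rw [List.map_map, Finset.sum_map_toList R (ENNReal.ofReal ∘ w)]
    exact Finset.le_sum_of_subadditive ENNReal.ofReal ENNReal.ofReal_zero.le
      (fun _ _ => ENNReal.ofReal_add_le) R w
  have h3 : ∀ L : List (β × ℝ), (∀ e ∈ L, 0 ≤ e.2) →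
      ((L.map Prod.snd).map ENNReal.ofReal).sum = ENNReal.ofReal (L.map Prod.snd).sum ∧
        0 ≤ (L.map Prod.snd).sum := by
    intro L
    induction L with
    | nil => simp
    | cons a L ih =>
      intro hL
      obtain ⟨i1, i2⟩ := ih fun e he => hL e (List.mem_cons_of_mem _ he)
      have ha := hL a (by simp)
      simp only [List.map_cons, List.sum_cons, i1]
      exact ⟨(ENNReal.ofReal_add ha i2).symm, add_nonneg ha i2⟩
  obtain ⟨e, h4⟩ := h3 L hL
  rw [e] at h1
  exact (ENNReal.ofReal_le_ofReal_iff h4).1 (h2.trans h1)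

/-! ### Expectations in the extended nonnegative reals. -/

section lexpect

/-- Expectation of an extended nonnegative random variable. -/
def lexpect {Ω : Type*} (P : PMF Ω) (g : Ω → ENNReal) : ENNReal := ∑' ω, P ω * g ω

variable {Ω Ω' : Type*}

theorem lexpect_pure (a : Ω) (g : Ω → ENNReal) : lexpect (PMF.pure a) g = g a := by
  classical
  unfold lexpect
  rw [tsum_eq_single a]
  · simp
  · intro b hb; simp [PMF.pure_apply, hb]

theorem lexpect_bind (P : PMF Ω) (k : Ω → PMF Ω') (g : Ω' → ENNReal) :
    lexpect (P.bind k) g = lexpect P fun a => lexpect (k a) g := by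
  simp only [lexpect, PMF.bind_apply]
  simp_rw [← ENNReal.tsum_mul_right]
  rw [ENNReal.tsum_comm]
  simp_rw [← ENNReal.tsum_mul_left, mul_assoc]

theorem lexpect_map (P : PMF Ω) (φ : Ω → Ω') (g : Ω' → ENNReal) :
    lexpect (P.map φ) g = lexpect P fun a => g (φ a) := by
  rw [← PMF.bind_pure_comp, lexpect_bind]
  simp [lexpect_pure]

theorem lexpect_mono {P : PMF Ω} {g h : Ω → ENNReal} (H : ∀ a ∈ P.support, g a ≤ h a) :
    lexpect P g ≤ lexpect P h := by
  refine ENNReal.tsum_le_tsum fun a => ?_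
  by_cases ha : P a = 0
  · simp [ha]
  · exact mul_le_mul_right (H a ((P.mem_support_iff a).2 ha)) _

theorem lexpect_add (P : PMF Ω) (g h : Ω → ENNReal) :
    lexpect P (fun a => g a + h a) = lexpect P g + lexpect P h := by
  simp only [lexpect, mul_add, ENNReal.tsum_add]

theorem lexpect_const_mul (P : PMF Ω) (c : ENNReal) (g : Ω → ENNReal) :
    lexpect P (fun a => c * g a) = c * lexpect P g := by
  simp only [lexpect, ← ENNReal.tsum_mul_left, mul_left_comm]

theorem lexpect_const (P : PMF Ω) (c : ENNReal) : lexpect P (fun _ => c) = c := by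
  simp only [lexpect, ENNReal.tsum_mul_right, P.tsum_coe, one_mul]

theorem lexpect_uniformOfFinset (B : Finset Ω) (hB : B.Nonempty) (g : Ω → ℝ)
    (hg : ∀ a ∈ B, 0 ≤ g a) :
    lexpect (PMF.uniformOfFinset B hB) (fun a => ENNReal.ofReal (g a))
      = ENNReal.ofReal ((∑ a ∈ B, g a) / B.card) := by
  have hc : (0 : ℝ) < B.card := by exact_mod_cast hB.card_pos
  unfold lexpect
  rw [tsum_eq_sum (s := B) (fun a ha => by
    rw [PMF.uniformOfFinset_apply_of_notMem hB ha, zero_mul])]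
  rw [div_eq_inv_mul, ENNReal.ofReal_mul (by positivity), ENNReal.ofReal_sum_of_nonneg hg,
    Finset.mul_sum]
  refine Finset.sum_congr rfl fun a ha => ?_
  rw [PMF.uniformOfFinset_apply_of_mem hB ha, ENNReal.ofReal_inv_of_pos hc, ENNReal.ofReal_natCast]

theorem expect_nonneg [Fintype Ω] (P : PMF Ω) {g : Ω → ℝ} (hg : ∀ a, 0 ≤ g a) :
    0 ≤ expect P g :=
  Finset.sum_nonneg fun _ _ => mul_nonneg ENNReal.toReal_nonneg (hg _)

/-- Solutions are lists, which form an infinite type, so the laws of the states are handled by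
`lexpect`. This transfers the results to the finite real expectations of sets. -/
theorem ofReal_expect [Fintype Ω] (P : PMF Ω) {g : Ω → ℝ} (hg : ∀ a, 0 ≤ g a) :
    ENNReal.ofReal (expect P g) = lexpect P fun a => ENNReal.ofReal (g a) := by
  unfold expect lexpect
  rw [tsum_fintype, ENNReal.ofReal_sum_of_nonneg
    fun a _ => mul_nonneg ENNReal.toReal_nonneg (hg a)]
  refine Finset.sum_congr rfl fun a _ => ?_
  rw [ENNReal.ofReal_mul ENNReal.toReal_nonneg, ENNReal.ofReal_toReal (P.apply_ne_top a)]

theorem ofReal_expect_map [Fintype Ω'] (P : PMF Ω) (φ : Ω → Ω') {g : Ω' → ℝ}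
    (hg : ∀ a, 0 ≤ g a) :
    ENNReal.ofReal (expect (P.map φ) g) = lexpect P fun a => ENNReal.ofReal (g (φ a)) := by
  rw [ofReal_expect _ hg, lexpect_map]

end lexpect

/-! ### The approximation factors. -/

section gamma

theorem gammaSeq_succ (p i : ℕ) (hi : 1 ≤ i) :
    gammaSeq p (i + 1) = 4 * p * (gammaSeq p i * (gammaSeq p i - 1)) /
      (gammaSeq p i - 1 + p) ^ 2 := by
  obtain ⟨j, rfl⟩ := Nat.exists_eq_add_of_le' hi
  rfl

/-- p+1 is a fixed point of the recursion. With γ = p+1+u, clearing denominators leaves the excess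
(3p-1)u² + 4p²u, which is positive for u > 0. -/
theorem lt_gammaSeq (p : ℕ) (hp : 1 ≤ p) (i : ℕ) (hi : 1 ≤ i) : (p : ℝ) + 1 < gammaSeq p i := by
  have hp' : (1 : ℝ) ≤ p := by exact_mod_cast hp
  induction i, hi using Nat.le_induction with
  | base => simp only [gammaSeq]; linarith
  | succ i hi ih =>
    rw [gammaSeq_succ p i hi]
    obtain ⟨u, hu⟩ : ∃ u, gammaSeq p i = u + p + 1 :=
      ⟨gammaSeq p i - p - 1, by ring⟩
    have hu0 : 0 < u := by linarith
    rw [hu, lt_div_iff₀ (by nlinarith)]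
    have : 0 < u * ((3 * p - 1) * u + 4 * p ^ 2) := by
      apply mul_pos hu0; nlinarith [mul_pos hu0 hu0]
    nlinarith

/-- For the excess u over p+1 one step gives at most 4pu/(u+4p), that is, 1/u grows by at least
1/(4p). Hence u ≤ 4p/i. -/
theorem gammaSeq_le (p : ℕ) (hp : 1 ≤ p) (i : ℕ) (hi : 1 ≤ i) :
    gammaSeq p i ≤ p + 1 + 4 * p / i := by
  have hp' : (1 : ℝ) ≤ p := by exact_mod_cast hp
  induction i, hi using Nat.le_induction with
  | base => simp [gammaSeq]; linarith
  | succ i hi ih =>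
    have hlt := lt_gammaSeq p hp i hi
    rw [gammaSeq_succ p i hi]
    obtain ⟨u, hu⟩ : ∃ u, gammaSeq p i = u + p + 1 :=
      ⟨gammaSeq p i - p - 1, by ring⟩
    have hu0 : 0 < u := by linarith
    have hi0 : (0 : ℝ) < i := by exact_mod_cast hi
    have hui : u * i ≤ 4 * p := by rw [← le_div_iff₀ hi0]; linarith
    have h1 : 4 * (p : ℝ) * ((u + p + 1) * (u + p + 1 - 1)) / (u + p + 1 - 1 + p) ^ 2
        ≤ p + 1 + 4 * p * u / (u + 4 * p) := by
      rw [div_le_iff₀ (by nlinarith)]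
      have e : (p + 1 + 4 * p * u / (u + 4 * p)) * (u + p + 1 - 1 + p) ^ 2
          = 4 * (p : ℝ) * ((u + p + 1) * (u + p + 1 - 1))
            + u ^ 3 * (p + 1) / (u + 4 * p) + 4 * p * u ^ 2 / (u + 4 * p) := by
        field_simp
        ring
      rw [e]
      have := div_nonneg (by positivity : 0 ≤ u ^ 3 * ((p : ℝ) + 1))
        (by positivity : 0 ≤ u + 4 * p)
      have := div_nonneg (by positivity : 0 ≤ 4 * p * u ^ 2)
        (by positivity : 0 ≤ u + 4 * p)
      linarith
    rw [hu]
    refine h1.trans ?_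
    have h2 : 4 * p * u / (u + 4 * p) ≤ 4 * p / ((i : ℝ) + 1) := by
      rw [div_le_div_iff₀ (by positivity) (by positivity)]
      nlinarith
    push_cast
    linarith

theorem gammaSeq_one (i : ℕ) (hi : 1 ≤ i) : gammaSeq 1 i = 2 + 2 / i := by
  induction i, hi using Nat.le_induction with
  | base => norm_num [gammaSeq]
  | succ i hi ih =>
    have hi0 : (0 : ℝ) < i := by exact_mod_cast hi
    rw [gammaSeq_succ 1 i hi, ih]
    push_cast
    field_simp
    ring

theorem betaSeq_one (i : ℕ) (hi : 1 ≤ i) : betaSeq 1 i = 1 / i := by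
  unfold betaSeq
  split_ifs with h
  · have : i = 1 := le_antisymm h hi
    subst this; simp
  · obtain ⟨j, rfl⟩ := Nat.exists_eq_add_of_le' hi
    have hj : 1 ≤ j := by omega
    have hi0 : (0 : ℝ) < j := by exact_mod_cast hj
    rw [Nat.add_sub_cancel, gammaSeq_one j hj]
    push_cast
    field_simp
    ring

theorem betaSeq_pos (p : ℕ) (hp : 1 ≤ p) (i : ℕ) : 0 < betaSeq p i := by
  have hp' : (1 : ℝ) ≤ p := by exact_mod_cast hp
  unfold betaSeq
  split_ifs with h
  · norm_num
  · have := lt_gammaSeq p hp (i - 1) (by omega)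
    exact div_pos (by linarith) (by linarith)

end gamma

/-! ### Incremental values along the order of acceptance. -/

section incr

variable {X : Type*} [DecidableEq X] {f : Finset X → ℝ}

theorem takeWhile_ne_append_of_mem {e : X} {S : List X} (he : e ∈ S) (T : List X) :
    (S ++ T).takeWhile (· ≠ e) = S.takeWhile (· ≠ e) := by
  induction S with
  | nil => simp at he
  | cons a S ih =>
    by_cases hae : a = e
    · simp [hae]
    · have : e ∈ S := by
        rcases List.mem_cons.1 he with h | h
        · exact absurd h.symm hae
        · exact h
      simp only [List.cons_append, List.takeWhile_cons, ih this]

theorem takeWhile_ne_append_of_notMem {e : X} {S : List X} (he : e ∉ S) :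
    (S ++ [e]).takeWhile (· ≠ e) = S := by
  induction S with
  | nil => simp
  | cons a S ih =>
    have h := List.not_mem_of_not_mem_cons he
    have hne : a ≠ e := fun h' => he (by simp [h'])
    simp only [List.cons_append, List.takeWhile_cons, ih h]
    simp [hne]

theorem takeWhile_ne_filter (q : X → Bool) {e : X} (hq : q e = true) (S : List X) :
    (S.filter q).takeWhile (· ≠ e) = (S.takeWhile (· ≠ e)).filter q := by
  induction S with
  | nil => rfl
  | cons a S ih =>
    by_cases hae : a = e
    · subst hae; simp [hq]
    · by_cases hqa : q a = true
      · simp only [List.filter_cons, hqa, if_true, List.takeWhile_cons, ih]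
        simp [hae, hqa]
      · simpa [List.filter_cons, hqa, List.takeWhile_cons, hae] using ih

theorem incr_append_of_mem {e : X} {S : List X} (he : e ∈ S) (T : List X) :
    incr f e (S ++ T) = incr f e S := by
  unfold incr
  rw [takeWhile_ne_append_of_mem he]

theorem incr_append_self {e : X} {S : List X} (he : e ∉ S) :
    incr f e (S ++ [e]) = f (insert e S.toFinset) - f S.toFinset := by
  unfold incr
  rw [takeWhile_ne_append_of_notMem he]

/-- Deleting other elements shrinks the prefix before e, so diminishing returns apply. -/
theorem incr_le_incr_filter (hf : IsSubmodular f) (q : X → Bool) {e : X} (hq : q e = true)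
    (S : List X) : incr f e S ≤ incr f e (S.filter q) := by
  unfold incr
  rw [takeWhile_ne_filter q hq]
  refine hf.marginal_anti (fun a ha => ?_) (fun h => ?_)
  · rw [List.mem_toFinset] at ha ⊢
    exact List.mem_of_mem_filter ha
  · rw [List.mem_toFinset] at h
    simpa using List.mem_takeWhile_imp h

theorem sum_incr {S : List X} (hS : S.Nodup) :
    ∑ e ∈ S.toFinset, incr f e S = f S.toFinset - f ∅ := by
  induction S using List.reverseRecOn with
  | nil => simp
  | append_singleton S a ih =>
    have h := List.nodup_append.1 hS
    have ha : a ∉ S := fun h' => h.2.2 a h' a (by simp) rfl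
    have e : (S ++ [a]).toFinset = insert a S.toFinset := by ext; simp
    rw [e, Finset.sum_insert (by simpa using ha), incr_append_self ha]
    have : ∑ x ∈ S.toFinset, incr f x (S ++ [a]) = ∑ x ∈ S.toFinset, incr f x S :=
      Finset.sum_congr rfl fun x hx => incr_append_of_mem (List.mem_toFinset.1 hx) _
    rw [this, ih h.1]
    ring

/-- The list is processed from its last element. T gathers the surviving later elements, so each
removed element is removed from a superset of its own prefix and costs at most its incremental
value. -/
theorem sub_sdiff_le_sum_incr (hf : IsSubmodular f) (C : Finset X) {S : List X} (hS : S.Nodup)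
    (T : Finset X) (hT : Disjoint S.toFinset T) :
    f (S.toFinset ∪ T) - f (S.toFinset \ C ∪ T) ≤ ∑ e ∈ S.toFinset ∩ C, incr f e S := by
  induction S using List.reverseRecOn generalizing T with
  | nil => simp
  | append_singleton S a ih =>
    have h := List.nodup_append.1 hS
    have ha : a ∉ S := fun h' => h.2.2 a h' a (by simp) rfl
    have e : (S ++ [a]).toFinset = insert a S.toFinset := by ext; simp
    rw [e] at hT ⊢
    rw [Finset.disjoint_insert_left] at hT
    have hsum : ∑ x ∈ S.toFinset ∩ C, incr f x (S ++ [a]) = ∑ x ∈ S.toFinset ∩ C, incr f x S :=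
      Finset.sum_congr rfl fun x hx =>
        incr_append_of_mem (List.mem_toFinset.1 (Finset.mem_inter.1 hx).1) _
    by_cases haC : a ∈ C
    · rw [Finset.insert_inter_of_mem haC, Finset.sum_insert (by simp [ha]), hsum,
        incr_append_self ha, Finset.insert_sdiff_of_mem _ haC]
      have h1 := ih h.1 T hT.2
      have h2 := hf.marginal_anti (A := S.toFinset) (B := S.toFinset ∪ T) (x := a)
        Finset.subset_union_left (by simp [ha, hT.1])
      rw [Finset.insert_union]
      linarith
    · rw [Finset.insert_inter_of_notMem haC, hsum, Finset.insert_sdiff_of_notMem _ haC]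
      have h1 := ih h.1 (insert a T) (Finset.disjoint_insert_right.2 ⟨by simpa using ha, hT.2⟩)
      simpa only [Finset.union_insert, Finset.insert_union] using h1

end incr

/-! ### Fundamental circuits and swap candidates. -/

namespace Matroid

variable {X : Type*} {N : Matroid X} {I : Set X} {x : X}

theorem Indep.fundCircuit_diff_subset (hI : N.Indep I) (hx : x ∈ N.E)
    (hd : ¬ N.Indep (insert x I)) :
    N.IsCircuit (N.fundCircuit x I) ∧
      N.fundCircuit x I \ {x} ⊆ {y | y ∈ I ∧ N.Indep (insert x (I \ {y}))} := by
  have hxI : x ∉ I := fun h => hd (by rwa [Set.insert_eq_of_mem h])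
  have hcl : x ∈ N.closure I := by
    by_contra h
    exact hd ((hI.insert_indep_iff_of_notMem hxI).2 ⟨hx, h⟩)
  refine ⟨hI.fundCircuit_isCircuit hcl hxI, ?_⟩
  rintro y ⟨hy, hyx⟩
  have hyx' : x ≠ y := fun h => hyx (by simp [h])
  have hyI : y ∈ I := (N.fundCircuit_subset_insert x I hy).resolve_left (fun h => hyx h)
  refine ⟨hyI, ?_⟩
  have := (hI.mem_fundCircuit_iff hcl hxI).1 hy
  rwa [Set.insert_sdiff_of_notMem _ (by simpa using hyx')] at this

/-- The fundamental circuit of x minus x consists of swap candidates and spans x. -/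
theorem Indep.mem_closure_swap (hI : N.Indep I) (hx : x ∈ N.E) (hd : ¬ N.Indep (insert x I)) :
    x ∈ N.closure {y | y ∈ I ∧ N.Indep (insert x (I \ {y}))} := by
  obtain ⟨hC, hsub⟩ := hI.fundCircuit_diff_subset hx hd
  exact N.closure_subset_closure hsub
    (hC.mem_closure_sdiff_singleton_of_mem (N.mem_fundCircuit x I))

theorem Indep.swap_mem_closure (hI : N.Indep I) (hx : x ∈ N.E) (hd : ¬ N.Indep (insert x I))
    {c : X} (hcx : N.Indep (insert x (I \ {c}))) :
    c ∈ N.closure (insert x ({y | y ∈ I ∧ N.Indep (insert x (I \ {y}))} \ {c})) := by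
  obtain ⟨hC, hsub⟩ := hI.fundCircuit_diff_subset hx hd
  -- Otherwise the circuit would lie inside the independent set I - c + x.
  have hcC : c ∈ N.fundCircuit x I := by
    by_contra h
    refine hC.not_indep (hcx.subset ?_)
    intro z hz
    by_cases hzx : z = x
    · exact Or.inl hzx
    · exact Or.inr ⟨(hsub ⟨hz, hzx⟩).1, fun h' => h (by rwa [← Set.mem_singleton_iff.1 h'])⟩
  refine N.closure_subset_closure ?_ (hC.mem_closure_sdiff_singleton_of_mem hcC)
  rintro z ⟨hz, hzc⟩
  by_cases hzx : z = x
  · exact Or.inl hzx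
  · exact Or.inr ⟨hsub ⟨hz, hzx⟩, hzc⟩

end Matroid

/-! ### Exchanges, and the spans of heavy elements. -/

namespace Matchoid

variable {X ι : Type*} {p : ℕ} {M : Matchoid X ι p} [DecidableEq X] {f : Finset X → ℝ}
  {pick : ι → X → List X → X} {α β : ℝ} {S : List X} {x y : X}

theorem indep_toFinset : M.Indep S.toFinset ↔ ∀ ℓ, (M.matroid ℓ).Indep (M.trace ℓ S) := by
  simp [Indep, trace]

theorem Indep.subset {T U : Finset X} (hT : M.Indep T) (h : U ⊆ T) : M.Indep U := fun ℓ =>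
  (hT ℓ).subset (Set.inter_subset_inter_left _ (by exact_mod_cast h))

variable [Fintype ι]

theorem card_filter_mem_ground_le (M : Matchoid X ι p) (e : X)
    [DecidablePred fun ℓ => e ∈ (M.matroid ℓ).E] :
    (Finset.univ.filter fun ℓ => e ∈ (M.matroid ℓ).E).card ≤ p := by
  have h := M.encard_le e
  have e1 : {ℓ | e ∈ (M.matroid ℓ).E}
      = ((Finset.univ.filter fun ℓ => e ∈ (M.matroid ℓ).E : Finset ι) : Set ι) := by
    ext; simp
  rw [e1, Set.encard_coe_eq_coe_finsetCard] at h
  exact_mod_cast h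

theorem mem_exchange {c : X} :
    c ∈ M.exchange pick x S ↔ ∃ ℓ, M.Conflict ℓ x S ∧ pick ℓ x S = c := by
  simp [exchange]

theorem Good.pick_mem (hg : M.Good f pick α β S x) (hp : M.IsArgminRule f pick) {ℓ : ι}
    (h : M.Conflict ℓ x S) : pick ℓ x S ∈ M.swapSet ℓ x S :=
  (hp ℓ x S (hg.1 ℓ h)).1

theorem Good.exchange_subset (hg : M.Good f pick α β S x) (hp : M.IsArgminRule f pick) :
    M.exchange pick x S ⊆ S.toFinset := by
  intro c hc
  obtain ⟨ℓ, h, rfl⟩ := mem_exchange.1 hc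
  exact List.mem_toFinset.2 (hg.pick_mem hp h).1.1

theorem toFinset_accept : (M.accept pick S x).toFinset
    = insert x (S.toFinset \ M.exchange pick x S) := by
  ext z; simp [accept]

theorem mem_accept {z : X} : z ∈ M.accept pick S x ↔
    z = x ∨ (z ∈ S ∧ z ∉ M.exchange pick x S) := by
  simp [accept, or_comm]

theorem indep_accept (hS : M.Indep S.toFinset) (hg : M.Good f pick α β S x)
    (hp : M.IsArgminRule f pick) : M.Indep (M.accept pick S x).toFinset := by
  rw [indep_toFinset] at hS ⊢
  intro ℓ
  by_cases hx : x ∈ (M.matroid ℓ).E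
  · by_cases hc : M.Conflict ℓ x S
    · refine (hg.pick_mem hp hc).2.subset ?_
      rintro z ⟨hz, hzE⟩
      rcases mem_accept.1 hz with h | ⟨h1, h2⟩
      · exact Or.inl h
      · refine Or.inr ⟨⟨h1, hzE⟩, ?_⟩
        rintro rfl
        exact h2 (mem_exchange.2 ⟨ℓ, hc, rfl⟩)
    · have : (M.matroid ℓ).Indep (insert x (M.trace ℓ S)) := by
        by_contra h; exact hc ⟨hx, h⟩
      refine this.subset ?_
      rintro z ⟨hz, hzE⟩
      rcases mem_accept.1 hz with h | ⟨h1, _⟩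
      · exact Or.inl h
      · exact Or.inr ⟨h1, hzE⟩
  · refine (hS ℓ).subset ?_
    rintro z ⟨hz, hzE⟩
    rcases mem_accept.1 hz with h | ⟨h1, _⟩
    · exact absurd (h ▸ hzE) hx
    · exact ⟨h1, hzE⟩

/-- A current solution which is independent, without repetition, and whose incremental values
are nonnegative. -/
structure Valid (M : Matchoid X ι p) (f : Finset X → ℝ) (S : List X) : Prop where
  nodup : S.Nodup
  indep : M.Indep S.toFinset
  incr_nonneg : ∀ e ∈ S, 0 ≤ incr f e S

theorem Valid.nil (M : Matchoid X ι p) (f : Finset X → ℝ) : M.Valid f [] :=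
  ⟨List.nodup_nil, fun ℓ => by simp, by simp⟩

namespace Valid

theorem sum_exchange_nonneg (hS : M.Valid f S) (hg : M.Good f pick α β S x)
    (hp : M.IsArgminRule f pick) : 0 ≤ ∑ e ∈ M.exchange pick x S, incr f e S :=
  Finset.sum_nonneg fun e he =>
    hS.incr_nonneg e (List.mem_toFinset.1 (hg.exchange_subset hp he))

/-- An element already present has marginal 0, which cannot reach α > 0. -/
theorem notMem_of_good (hS : M.Valid f S) (hg : M.Good f pick α β S x)
    (hp : M.IsArgminRule f pick) (hα : 0 < α) (hβ : 0 ≤ β) : x ∉ S := by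
  intro hx
  have h := hg.2
  rw [Finset.insert_eq_of_mem (List.mem_toFinset.2 hx), sub_self] at h
  have := mul_nonneg (by linarith : 0 ≤ 1 + β) (hS.sum_exchange_nonneg hg hp)
  linarith

theorem le_incr_accept_self (hf : IsSubmodular f) (hS : M.Valid f S)
    (hg : M.Good f pick α β S x) (hp : M.IsArgminRule f pick) (hα : 0 < α) (hβ : 0 ≤ β) :
    α + (1 + β) * ∑ e ∈ M.exchange pick x S, incr f e S
      ≤ incr f x (M.accept pick S x) := by
  have hx := hS.notMem_of_good hg hp hα hβ
  have h1 : x ∉ S.filter fun y => y ∉ M.exchange pick x S := fun h => hx (List.mem_of_mem_filter h)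
  unfold accept
  rw [incr_append_self h1]
  refine hg.2.trans (hf.marginal_anti (fun z hz => ?_) (by simpa using hx))
  rw [List.mem_toFinset] at hz ⊢
  exact List.mem_of_mem_filter hz

theorem incr_le_incr_accept (hf : IsSubmodular f) {e : X} (he : e ∈ S)
    (heC : e ∉ M.exchange pick x S) : incr f e S ≤ incr f e (M.accept pick S x) := by
  unfold accept
  rw [incr_append_of_mem (List.mem_filter.2 ⟨he, by simpa using heC⟩)]
  exact incr_le_incr_filter hf _ (by simpa using heC) S

theorem accept (hf : IsSubmodular f) (hS : M.Valid f S) (hg : M.Good f pick α β S x)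
    (hp : M.IsArgminRule f pick) (hα : 0 < α) (hβ : 0 ≤ β) :
    M.Valid f (M.accept pick S x) where
  nodup := by
    refine List.nodup_append.2 ⟨hS.nodup.filter _, List.nodup_singleton x, ?_⟩
    rintro a ha b hb rfl
    rw [List.mem_singleton] at hb
    subst hb
    exact hS.notMem_of_good hg hp hα hβ (List.mem_of_mem_filter ha)
  indep := indep_accept hS.indep hg hp
  incr_nonneg := by
    intro e he
    rcases mem_accept.1 he with rfl | ⟨h1, h2⟩
    · have := mul_nonneg (by linarith : 0 ≤ 1 + β) (hS.sum_exchange_nonneg hg hp)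
      have := hS.le_incr_accept_self hf hg hp hα hβ
      linarith
    · exact (hS.incr_nonneg e h1).trans (incr_le_incr_accept hf h1 h2)

theorem insert_sub_accept_le (hf : IsSubmodular f) (hS : M.Valid f S)
    (hg : M.Good f pick α β S x) (hp : M.IsArgminRule f pick) (hα : 0 < α) (hβ : 0 ≤ β) :
    f (insert x S.toFinset) - f (M.accept pick S x).toFinset
      ≤ ∑ e ∈ M.exchange pick x S, incr f e S := by
  have hx := hS.notMem_of_good hg hp hα hβ
  have h := sub_sdiff_le_sum_incr hf (M.exchange pick x S) hS.nodup {x} (by simpa using hx)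
  rw [Finset.inter_eq_right.2 (hg.exchange_subset hp)] at h
  rw [toFinset_accept]
  simpa only [Finset.union_singleton] using h

/-- The test guarantees α + (1+β)∑ν from adding x, and the evictions cost at most ∑ν. -/
theorem le_accept (hf : IsSubmodular f) (hS : M.Valid f S)
    (hg : M.Good f pick α β S x) (hp : M.IsArgminRule f pick) (hα : 0 < α) (hβ : 0 ≤ β) :
    f S.toFinset + α + β * ∑ e ∈ M.exchange pick x S, incr f e S
      ≤ f (M.accept pick S x).toFinset := by
  have h1 := hS.insert_sub_accept_le hf hg hp hα hβ
  have h2 := hg.2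
  linarith

end Valid

/-- The elements of a list of weighted elements whose weight is at least `θ`. -/
def level (L : List (X × ℝ)) (θ : ℝ) : Set X := {e | ∃ v, (e, v) ∈ L ∧ θ ≤ v}

open Classical in
/-- The elements of the current solution in the `ℓ`-th ground set with their incremental values. -/
def entries (M : Matchoid X ι p) (f : Finset X → ℝ) (ℓ : ι) (S : List X) : List (X × ℝ) :=
  (S.filter fun e => e ∈ (M.matroid ℓ).E).map fun e => (e, incr f e S)

open Classical in
/-- The elements of the `ℓ`-th ground set which are evicted on the arrival of `x`, but not for
the sake of the `ℓ`-th matroid, with their incremental values. -/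
def evicted (M : Matchoid X ι p) (f : Finset X → ℝ) (pick : ι → X → List X → X) (x : X)
    (S : List X) (ℓ : ι) : List (X × ℝ) :=
  ((M.exchange pick x S).filter fun e => e ∈ (M.matroid ℓ).E ∧
    ¬ (M.Conflict ℓ x S ∧ e = pick ℓ x S)).toList.map fun e => (e, incr f e S)

theorem mem_level_append {L L' : List (X × ℝ)} {θ : ℝ} {e : X} :
    e ∈ level (L ++ L') θ ↔ e ∈ level L θ ∨ e ∈ level L' θ := by
  simp only [level, List.mem_append, Set.mem_ofPred_eq, or_and_right, exists_or]

theorem mem_level_entries {ℓ : ι} {θ : ℝ} {e : X} :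
    e ∈ level (M.entries f ℓ S) θ ↔ e ∈ S ∧ e ∈ (M.matroid ℓ).E ∧ θ ≤ incr f e S := by
  simp [level, entries, and_assoc]

theorem mem_level_evicted {ℓ : ι} {θ : ℝ} {e : X} :
    e ∈ level (M.evicted f pick x S ℓ) θ ↔ e ∈ M.exchange pick x S ∧ e ∈ (M.matroid ℓ).E ∧
      ¬ (M.Conflict ℓ x S ∧ e = pick ℓ x S) ∧ θ ≤ incr f e S := by
  simp only [level, evicted, List.mem_map, Finset.mem_toList, Finset.mem_filter,
    Prod.mk.injEq, Set.mem_ofPred_eq]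
  constructor
  · rintro ⟨v, ⟨a, ⟨h1, h2, h3⟩, rfl, rfl⟩, hv⟩
    exact ⟨h1, h2, h3, hv⟩
  · rintro ⟨h1, h2, h3, h4⟩
    exact ⟨_, ⟨e, ⟨h1, h2, h3⟩, rfl, rfl⟩, h4⟩

/-- Kept elements only gain incremental value, and those evicted for other matroids reappear in
`evicted`. The only loss is the element c picked for the ℓ-th matroid. By minimality the other swap
candidates weigh at least as much as c, and by the test so does x; the fundamental circuit of x puts
c in their span. -/
theorem level_subset_closure_accept (hf : IsSubmodular f) (hS : M.Valid f S)
    (hg : M.Good f pick α β S x) (hp : M.IsArgminRule f pick) (hα : 0 < α) (hβ : 0 ≤ β)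
    (ℓ : ι) (θ : ℝ) :
    level (M.entries f ℓ S) θ ⊆ (M.matroid ℓ).closure
      (level (M.entries f ℓ (M.accept pick S x) ++ M.evicted f pick x S ℓ) θ) := by
  have hkeep : ∀ e ∈ level (M.entries f ℓ S) θ, ¬ (M.Conflict ℓ x S ∧ e = pick ℓ x S) →
      e ∈ level (M.entries f ℓ (M.accept pick S x) ++ M.evicted f pick x S ℓ) θ := by
    intro e he hne
    rw [mem_level_entries] at he
    rw [mem_level_append, mem_level_entries, mem_level_evicted]
    by_cases heC : e ∈ M.exchange pick x S
    · exact Or.inr ⟨heC, he.2.1, hne, he.2.2⟩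
    · exact Or.inl ⟨mem_accept.2 (Or.inr ⟨he.1, heC⟩), he.2.1,
        he.2.2.trans (Valid.incr_le_incr_accept hf he.1 heC)⟩
  intro e he
  have he' := mem_level_entries.1 he
  by_cases hne : M.Conflict ℓ x S ∧ e = pick ℓ x S
  · obtain ⟨hc, hpick⟩ := hne
    have hsw := hg.pick_mem hp hc
    rw [← hpick] at hsw
    have hcl := (indep_toFinset.1 hS.indep ℓ).swap_mem_closure hc.1 hc.2 hsw.2
    refine Matroid.closure_subset_closure _ ?_ hcl
    rintro z (rfl | ⟨hz, hze⟩)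
    · rw [mem_level_append, mem_level_entries]
      refine Or.inl ⟨mem_accept.2 (Or.inl rfl), hc.1, he'.2.2.trans ?_⟩
      have h1 := hS.le_incr_accept_self hf hg hp hα hβ
      have h2 : incr f e S ≤ ∑ e ∈ M.exchange pick z S, incr f e S :=
        Finset.single_le_sum (f := fun e => incr f e S) (fun i hi => hS.incr_nonneg i
          (List.mem_toFinset.1 (hg.exchange_subset hp hi)))
          (mem_exchange.2 ⟨ℓ, hc, hpick.symm⟩)
      have h3 := mul_nonneg hβ (hS.sum_exchange_nonneg hg hp)
      linarith
    · refine hkeep z (mem_level_entries.2 ⟨hz.1.1, hz.1.2, he'.2.2.trans ?_⟩)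
        fun h => hze (by rw [hpick, h.2]; rfl)
      rw [hpick]
      exact (hp ℓ x S (hg.1 ℓ hc)).2 z hz
  · exact Matroid.mem_closure_of_mem' _ (hkeep e he hne) he'.2.1

/-- An evicted element lies in at most p ground sets, and the matroid for which it was picked does
not list it. -/
theorem sum_evicted_le (hS : M.Valid f S) (hg : M.Good f pick α β S x)
    (hp : M.IsArgminRule f pick) :
    ∑ ℓ, ((M.evicted f pick x S ℓ).map Prod.snd).sum
      ≤ (p - 1) * ∑ e ∈ M.exchange pick x S, incr f e S := by
  classical
  have e1 : ∀ ℓ, ((M.evicted f pick x S ℓ).map Prod.snd).sum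
      = ∑ e ∈ M.exchange pick x S, if e ∈ (M.matroid ℓ).E ∧
        ¬ (M.Conflict ℓ x S ∧ e = pick ℓ x S) then incr f e S else 0 := by
    intro ℓ
    rw [evicted, List.map_map, ← Finset.sum_filter]
    rw [show (Prod.snd ∘ fun e => (e, incr f e S)) = fun e => incr f e S from rfl,
      Finset.sum_map_toList]
  simp_rw [e1]
  rw [Finset.sum_comm, Finset.mul_sum]
  refine Finset.sum_le_sum fun e he => ?_
  rw [← Finset.sum_filter, Finset.sum_const, nsmul_eq_mul]
  refine mul_le_mul_of_nonneg_right ?_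
    (hS.incr_nonneg e (List.mem_toFinset.1 (hg.exchange_subset hp he)))
  obtain ⟨ℓ₀, hc, hpick⟩ := mem_exchange.1 he
  have hmem : ℓ₀ ∈ Finset.univ.filter fun ℓ => e ∈ (M.matroid ℓ).E := by
    rw [Finset.mem_filter, ← hpick]
    exact ⟨Finset.mem_univ _, (hg.pick_mem hp hc).1.2⟩
  have hlt : (Finset.univ.filter fun ℓ => e ∈ (M.matroid ℓ).E ∧
      ¬ (M.Conflict ℓ x S ∧ e = pick ℓ x S)).card
      < (Finset.univ.filter fun ℓ => e ∈ (M.matroid ℓ).E).card := by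
    refine Finset.card_lt_card (Finset.ssubset_iff_subset_ne.2 ⟨?_, ?_⟩)
    · intro ℓ hℓ
      simp only [Finset.mem_filter] at hℓ ⊢
      exact ⟨hℓ.1, hℓ.2.1⟩
    · intro h
      rw [← h] at hmem
      exact (Finset.mem_filter.1 hmem).2.2 ⟨hc, hpick.symm⟩
  have h2 := hlt.trans_le (M.card_filter_mem_ground_le e)
  have h3 : ((Finset.univ.filter fun ℓ => e ∈ (M.matroid ℓ).E ∧
      ¬ (M.Conflict ℓ x S ∧ e = pick ℓ x S)).card : ℝ) + 1 ≤ p := by exact_mod_cast h2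
  linarith

theorem sum_entries_le (hS : M.Valid f S) (h0 : 0 ≤ f ∅) :
    ∑ ℓ, ((M.entries f ℓ S).map Prod.snd).sum ≤ p * f S.toFinset := by
  classical
  have e1 : ∀ ℓ, ((M.entries f ℓ S).map Prod.snd).sum
      = ∑ e ∈ S.toFinset, if e ∈ (M.matroid ℓ).E then incr f e S else 0 := by
    intro ℓ
    rw [entries, List.map_map, ← Finset.sum_filter]
    rw [show (Prod.snd ∘ fun e => (e, incr f e S)) = fun e => incr f e S from rfl,
      ← List.sum_toFinset _ (hS.nodup.filter _), List.toFinset_filter]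
    congr! 1
    ext; simp
  simp_rw [e1]
  rw [Finset.sum_comm]
  have h1 : ∑ e ∈ S.toFinset, ∑ ℓ, (if e ∈ (M.matroid ℓ).E then incr f e S else 0)
      ≤ ∑ e ∈ S.toFinset, p * incr f e S := by
    refine Finset.sum_le_sum fun e he => ?_
    rw [← Finset.sum_filter, Finset.sum_const, nsmul_eq_mul]
    refine mul_le_mul_of_nonneg_right ?_ (hS.incr_nonneg e (List.mem_toFinset.1 he))
    exact_mod_cast M.card_filter_mem_ground_le e
  refine h1.trans ?_
  rw [← Finset.mul_sum, sum_incr hS.nodup]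
  have := mul_nonneg (Nat.cast_nonneg p : (0 : ℝ) ≤ p) h0
  linarith

/-- A charging scheme for an element `x` which does not belong to the set `A` of all elements
accepted so far: the marginal value of `x` is paid for by weights, each of which is bounded by the
weights of elements spanning `x`. -/
def Rejected (M : Matchoid X ι p) (f : Finset X → ℝ) (α β : ℝ) (A : Finset X)
    (L : ι → List (X × ℝ)) (x : X) : Prop :=
  ∃ w : ι → ℝ, (∀ ℓ, 0 ≤ w ℓ) ∧ f (insert x A) - f A ≤ α + (1 + β) * ∑ ℓ, w ℓ ∧
    ∀ ℓ, 0 < w ℓ → x ∈ (M.matroid ℓ).closure (level (L ℓ) (w ℓ))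

theorem Rejected.mono (hf : IsSubmodular f) {A A' : Finset X} {L L' : ι → List (X × ℝ)}
    (h : M.Rejected f α β A L x) (hA : A ⊆ A') (hx : x ∉ A')
    (hL : ∀ ℓ θ, 0 < θ → level (L ℓ) θ ⊆ (M.matroid ℓ).closure (level (L' ℓ) θ)) :
    M.Rejected f α β A' L' x := by
  obtain ⟨w, h1, h2, h3⟩ := h
  refine ⟨w, h1, (hf.marginal_anti hA hx).trans h2, fun ℓ hℓ => ?_⟩
  exact Matroid.closure_subset_closure_of_subset_closure (hL ℓ _ hℓ) (h3 ℓ hℓ)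

/-- The weight w_ℓ is the least incremental value of a swap candidate in a conflicting matroid and 0
elsewhere. The candidates span x and all have weight at least w_ℓ. -/
theorem rejected_of_not_good (hf : IsSubmodular f) (hS : M.Valid f S)
    (hp : M.IsArgminRule f pick) (hβ : 0 ≤ β) {O A : Finset X} (hO : M.Indep O) (hxO : x ∈ O)
    (hSA : S.toFinset ⊆ A) (hxA : x ∉ A) (hg : ¬ M.Good f pick α β S x)
    (L : ι → List (X × ℝ)) : M.Rejected f α β A (fun ℓ => M.entries f ℓ S ++ L ℓ) x := by
  classical
  have hmem : ∀ ℓ, M.Conflict ℓ x S → x ∈ (M.matroid ℓ).closure (M.swapSet ℓ x S) := fun ℓ hc =>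
    (indep_toFinset.1 hS.indep ℓ).mem_closure_swap hc.1 hc.2
  -- Without candidates x would be a loop, which an independent O cannot contain. So the test failed
  -- because of its inequality.
  have hne : ∀ ℓ, M.Conflict ℓ x S → (M.swapSet ℓ x S).Nonempty := by
    intro ℓ hc
    by_contra h
    have h1 := hmem ℓ hc
    rw [Set.not_nonempty_iff_eq_empty.1 h] at h1
    exact ((hO ℓ).isNonloop_of_mem ⟨by simpa using hxO, hc.1⟩).not_isLoop h1
  have hpick : ∀ ℓ, M.Conflict ℓ x S → pick ℓ x S ∈ S := fun ℓ hc => (hp ℓ x S (hne ℓ hc)).1.1.1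
  refine ⟨fun ℓ => if M.Conflict ℓ x S then incr f (pick ℓ x S) S else 0, ?_, ?_, ?_⟩
  · intro ℓ
    dsimp only
    split_ifs with hc
    · exact hS.incr_nonneg _ (hpick ℓ hc)
    · exact le_rfl
  · have h1 : f (insert x S.toFinset) - f S.toFinset
        ≤ α + (1 + β) * ∑ e ∈ M.exchange pick x S, incr f e S := by
      by_contra h
      exact hg ⟨hne, (not_le.1 h).le⟩
    have h2 := hf.marginal_anti hSA hxA
    -- One element may be picked for several matroids; nonnegativity makes the sum over matroids the
    -- larger one.
    have h3 : ∑ e ∈ M.exchange pick x S, incr f e S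
        ≤ ∑ ℓ, if M.Conflict ℓ x S then incr f (pick ℓ x S) S else 0 := by
      rw [← Finset.sum_filter]
      unfold exchange
      convert Finset.sum_image_le_of_nonneg (f := fun e => incr f e S)
        (g := fun ℓ => pick ℓ x S) ?_
      intro e he
      obtain ⟨ℓ, hℓ, rfl⟩ := Finset.mem_image.1 he
      exact hS.incr_nonneg _ (hpick ℓ (Finset.mem_filter.1 hℓ).2)
    have h4 := mul_le_mul_of_nonneg_left h3 (by linarith : 0 ≤ 1 + β)
    linarith
  · intro ℓ hℓ
    dsimp only at hℓ ⊢
    split_ifs at hℓ ⊢ with hc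
    · refine Matroid.closure_subset_closure _ ?_ (hmem ℓ hc)
      intro z hz
      rw [mem_level_append, mem_level_entries]
      exact Or.inl ⟨hz.1.1, hz.1.2, (hp ℓ x S (hne ℓ hc)).2 z hz⟩
    · exact absurd hℓ (lt_irrefl _)

end Matchoid

/-! ### The charging certificate of a pass. -/

namespace Matchoid

variable {X ι : Type*} {p : ℕ} {M : Matchoid X ι p} [DecidableEq X] {f : Finset X → ℝ}
  {pick : ι → X → List X → X} {α β : ℝ} {S : List X} {x y : X} [Fintype ι]

/-- The charging scheme maintained during a pass started from a solution of value `v₀`, where `S` is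
the current solution, `B` is the buffer, `A` consists of the elements accepted so far (and the
initial ones), `E` is the total value of the evicted elements at the time of their eviction, and
`sink ℓ` lists the elements evicted for the sake of matroids other than the `ℓ`-th one. -/
structure Certificate (M : Matchoid X ι p) (f : Finset X → ℝ) (α β v₀ : ℝ) (O : Finset X)
    (seen : Set X) (S : List X) (B A : Finset X) (E : ℝ) (sink : ι → List (X × ℝ)) : Prop where
  subset : S.toFinset ⊆ A
  nonneg : 0 ≤ E
  le_add : f A ≤ f S.toFinset + E
  gain : v₀ + β * E ≤ f S.toFinset
  sink_ground : ∀ ℓ, ∀ e ∈ sink ℓ, e.1 ∈ (M.matroid ℓ).E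
  sink_nonneg : ∀ ℓ, ∀ e ∈ sink ℓ, 0 ≤ e.2
  sink_sum : ∑ ℓ, ((sink ℓ).map Prod.snd).sum ≤ (p - 1) * E
  covered : ∀ x ∈ O, x ∈ seen → x ∉ A → x ∉ B →
    M.Rejected f α β A (fun ℓ => M.entries f ℓ S ++ sink ℓ) x

namespace Certificate

variable {v₀ : ℝ} {O : Finset X} {seen : Set X} {B A : Finset X} {E : ℝ}
  {sink : ι → List (X × ℝ)}

theorem init (M : Matchoid X ι p) (f : Finset X → ℝ) (α β : ℝ) (O : Finset X) (S : List X) :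
    M.Certificate f α β (f S.toFinset) O ∅ S ∅ S.toFinset 0 (fun _ => []) where
  subset := subset_rfl
  nonneg := le_rfl
  le_add := by simp
  gain := by simp
  sink_ground := by simp
  sink_nonneg := by simp
  sink_sum := by simp
  covered := by simp

theorem arrive (hf : IsSubmodular f) (hS : M.Valid f S) (hp : M.IsArgminRule f pick)
    (hβ : 0 ≤ β) (hO : M.Indep O) (hc : M.Certificate f α β v₀ O seen S B A E sink)
    {B' : Finset X} (hB : B ⊆ B') (hx : M.Good f pick α β S x → x ∈ B') :
    M.Certificate f α β v₀ O (insert x seen) S B' A E sink where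
  subset := hc.subset
  nonneg := hc.nonneg
  le_add := hc.le_add
  gain := hc.gain
  sink_ground := hc.sink_ground
  sink_nonneg := hc.sink_nonneg
  sink_sum := hc.sink_sum
  covered := by
    rintro z hzO (rfl | hz) hzA hzB
    · exact rejected_of_not_good hf hS hp hβ hO hzO hc.subset hzA (fun h => hzB (hx h)) _
    · exact hc.covered z hzO hz hzA fun h => hzB (hB h)

theorem accept (hf : IsSubmodular f) (hS : M.Valid f S) (hp : M.IsArgminRule f pick)
    (hα : 0 < α) (hβ : 0 ≤ β) (hO : M.Indep O)
    (hc : M.Certificate f α β v₀ O seen S B A E sink) (hg : M.Good f pick α β S x)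
    {B' : Finset X}
    (hB : ∀ z ∈ B, z ≠ x → M.Good f pick α β (M.accept pick S x) z → z ∈ B') :
    M.Certificate f α β v₀ O seen (M.accept pick S x) B' (A ∪ (M.accept pick S x).toFinset)
      (E + ∑ e ∈ M.exchange pick x S, incr f e S)
      (fun ℓ => sink ℓ ++ M.evicted f pick x S ℓ) := by
  have hxS := hS.notMem_of_good hg hp hα hβ
  have hS' := hS.accept hf hg hp hα hβ
  have hC := hS.sum_exchange_nonneg hg hp
  have hA' : A ∪ (M.accept pick S x).toFinset = insert x A := by
    ext z
    rw [toFinset_accept]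
    simp only [Finset.mem_union, Finset.mem_insert, Finset.mem_sdiff]
    constructor
    · rintro (h | h | ⟨h, _⟩)
      · exact Or.inr h
      · exact Or.inl h
      · exact Or.inr (hc.subset h)
    · rintro (h | h)
      · exact Or.inr (Or.inl h)
      · exact Or.inl h
  have hadd : f (insert x S.toFinset) - f (M.accept pick S x).toFinset
      ≤ ∑ e ∈ M.exchange pick x S, incr f e S := hS.insert_sub_accept_le hf hg hp hα hβ
  have hle := hS.le_accept hf hg hp hα hβ
  have hsub : S.toFinset ⊆ A := hc.subset
  refine ⟨Finset.subset_union_right, add_nonneg hc.nonneg hC, ?_, ?_, ?_, ?_, ?_, ?_⟩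
  · rw [hA']
    have h1 := hc.le_add
    -- An element of A evicted earlier may be accepted again; then A does not change and f(S) + E
    -- does not decrease.
    by_cases hxA : x ∈ A
    · rw [Finset.insert_eq_of_mem hxA]
      have h2 := hg.2
      have := mul_nonneg (by linarith : 0 ≤ 1 + β) hC
      linarith
    · have h2 := hf.marginal_anti hsub hxA
      linarith
  · have h1 := hc.gain
    linarith
  · intro ℓ e he
    rcases List.mem_append.1 he with h | h
    · exact hc.sink_ground ℓ e h
    · simp only [evicted, List.mem_map, Finset.mem_toList, Finset.mem_filter] at h
      obtain ⟨a, ⟨_, h2, _⟩, rfl⟩ := h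
      exact h2
  · intro ℓ e he
    rcases List.mem_append.1 he with h | h
    · exact hc.sink_nonneg ℓ e h
    · simp only [evicted, List.mem_map, Finset.mem_toList, Finset.mem_filter] at h
      obtain ⟨a, ⟨h1, _⟩, rfl⟩ := h
      exact hS.incr_nonneg a (List.mem_toFinset.1 (hg.exchange_subset hp h1))
  · simp only [List.map_append, List.sum_append, Finset.sum_add_distrib]
    have h1 := hc.sink_sum
    have h2 := sum_evicted_le hS hg hp
    linarith
  · intro z hzO hz hzA hzB
    -- An element just purged from the buffer is charged afresh to the new solution; an older
    -- rejection is carried over through spans.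
    by_cases hzB0 : z ∈ B
    · have hzx : z ≠ x := by
        rintro rfl
        exact hzA (hA' ▸ Finset.mem_insert_self _ _)
      exact rejected_of_not_good hf hS' hp hβ hO hzO Finset.subset_union_right hzA
        (fun h => hzB (hB z hzB0 hzx h)) _
    · refine (hc.covered z hzO hz (fun h => hzA (Finset.mem_union_left _ h)) hzB0).mono hf
        Finset.subset_union_left hzA ?_
      intro ℓ θ _ e he
      rcases mem_level_append.1 he with h | h
      · refine Matroid.closure_subset_closure _ ?_
          (level_subset_closure_accept hf hS hg hp hα hβ ℓ θ h)
        intro a ha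
        rw [mem_level_append] at ha ⊢
        exact ha.imp_right fun h => mem_level_append.2 (Or.inr h)
      · obtain ⟨v, hv, _⟩ := id h
        refine Matroid.mem_closure_of_mem' _ ?_ (hc.sink_ground ℓ _ hv)
        exact mem_level_append.2 (Or.inr (mem_level_append.2 (Or.inl h)))

theorem bound (hf : IsSubmodular f) (h0 : ∀ T, 0 ≤ f T) (hS : M.Valid f S) (hα : 0 < α)
    (hβ : 0 < β) (hO : M.Indep O) {k : ℕ} (hk : O.card ≤ k) (hp1 : 1 ≤ p)
    (hc : M.Certificate f α β v₀ O seen S B A E sink) (hseen : ∀ x ∈ O, x ∈ seen) :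
    f (O ∪ A) + (p / β + p - 1) * v₀
      ≤ k * α + (p * (1 + β) ^ 2 / β) * f S.toFinset + f (O ∩ B) := by
  have hp' : (1 : ℝ) ≤ p := by exact_mod_cast hp1
  set R := O \ (A ∪ B) with hR
  have hRA : ∀ x ∈ R, x ∉ A := fun x hx h =>
    (Finset.mem_sdiff.1 hx).2 (Finset.mem_union_left _ h)
  have hRB : ∀ x ∈ R, x ∉ B := fun x hx h =>
    (Finset.mem_sdiff.1 hx).2 (Finset.mem_union_right _ h)
  have hRO : ∀ x ∈ R, x ∈ O := fun x hx => (Finset.mem_sdiff.1 hx).1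
  have h1 : f (O ∪ A) ≤ f (A ∪ (O ∩ B)) + ∑ x ∈ R, (f (insert x A) - f A) := by
    have e : O ∪ A = A ∪ (O ∩ B) ∪ R := by
      ext z
      simp only [hR, Finset.mem_union, Finset.mem_inter, Finset.mem_sdiff]
      tauto
    rw [e]
    refine hf.union_le_add_sum A R hRA _ Finset.subset_union_left fun x hx h => ?_
    rcases Finset.mem_union.1 h with h | h
    · exact hRA x hx h
    · exact hRB x hx (Finset.mem_inter.1 h).2
  have h2 : f (A ∪ (O ∩ B)) ≤ f A + f (O ∩ B) := by
    have := hf A (O ∩ B)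
    have := h0 (A ∩ (O ∩ B))
    linarith
  have hrej : ∀ x, ∃ w : ι → ℝ, x ∈ R → (∀ ℓ, 0 ≤ w ℓ) ∧
      f (insert x A) - f A ≤ α + (1 + β) * ∑ ℓ, w ℓ ∧
      ∀ ℓ, 0 < w ℓ → x ∈ (M.matroid ℓ).closure (level (M.entries f ℓ S ++ sink ℓ) (w ℓ)) := by
    intro x
    by_cases hx : x ∈ R
    · obtain ⟨w, hw⟩ := hc.covered x (hRO x hx) (hseen x (hRO x hx)) (hRA x hx) (hRB x hx)
      exact ⟨w, fun _ => hw⟩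
    · exact ⟨0, fun h => absurd h hx⟩
  choose w hw using hrej
  have hentry : ∀ ℓ, ∀ e ∈ M.entries f ℓ S ++ sink ℓ, 0 ≤ e.2 := by
    intro ℓ e he
    rcases List.mem_append.1 he with h | h
    · simp only [entries, List.mem_map, List.mem_filter] at h
      obtain ⟨a, ⟨h1, _⟩, rfl⟩ := h
      exact hS.incr_nonneg a h1
    · exact hc.sink_nonneg ℓ e h
  -- The elements charged at least θ form an independent set inside the span of the entries of
  -- weight at least θ, so they are at most as many as these entries.
  have h3 : ∀ ℓ, ∑ x ∈ R, w x ℓ ≤ ((M.entries f ℓ S ++ sink ℓ).map Prod.snd).sum := by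
    intro ℓ
    refine sum_le_sum_of_card_threshold_le R (fun x => w x ℓ) _ (hentry ℓ) fun θ hθ => ?_
    set L := M.entries f ℓ S ++ sink ℓ with hL
    have hlev : (level L θ).encard ≤ ((L.filter fun e => θ ≤ e.2).length : ℕ∞) := by
      have e : level L θ ⊆ (((L.filter fun e => θ ≤ e.2).map Prod.fst).toFinset : Set X) := by
        rintro e ⟨v, hv, hθv⟩
        simp only [List.coe_toFinset, Set.mem_ofPred_eq, List.mem_map, List.mem_filter]
        exact ⟨(e, v), ⟨hv, by simpa using hθv⟩, rfl⟩
      refine (Set.encard_le_encard e).trans ?_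
      rw [Set.encard_coe_eq_coe_finsetCard]
      have := List.toFinset_card_le ((L.filter fun e => θ ≤ e.2).map Prod.fst)
      rw [List.length_map] at this
      exact_mod_cast this
    have hcl : ((R.filter fun x => θ ≤ w x ℓ : Finset X) : Set X)
        ⊆ (M.matroid ℓ).closure (level L θ) := by
      intro x hx
      obtain ⟨hxR, hxθ⟩ := Finset.mem_filter.1 (Finset.mem_coe.1 hx)
      refine Matroid.closure_subset_closure _ ?_ ((hw x hxR).2.2 ℓ (hθ.trans_le hxθ))
      rintro e ⟨v, hv, hv'⟩
      exact ⟨v, hv, hxθ.trans hv'⟩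
    have hind : (M.matroid ℓ).Indep ((R.filter fun x => θ ≤ w x ℓ : Finset X) : Set X) := by
      refine (hO ℓ).subset fun x hx => ⟨?_, Matroid.mem_ground_of_mem_closure (hcl hx)⟩
      exact Finset.mem_coe.2 (hRO x (Finset.mem_filter.1 (Finset.mem_coe.1 hx)).1)
    have := hind.encard_le_eRk_of_subset hcl
    rw [Matroid.eRk_closure_eq] at this
    have := (this.trans (Matroid.eRk_le_encard _ _)).trans hlev
    rw [Set.encard_coe_eq_coe_finsetCard] at this
    exact_mod_cast this
  have h4 : ∑ x ∈ R, (f (insert x A) - f A)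
      ≤ k * α + (1 + β) * (p * f S.toFinset + (p - 1) * E) := by
    have e1 : ∑ x ∈ R, (f (insert x A) - f A) ≤ ∑ x ∈ R, (α + (1 + β) * ∑ ℓ, w x ℓ) :=
      Finset.sum_le_sum fun x hx => (hw x hx).2.1
    rw [Finset.sum_add_distrib, ← Finset.mul_sum, Finset.sum_const, nsmul_eq_mul,
      Finset.sum_comm] at e1
    have e2 : ∑ ℓ, ∑ x ∈ R, w x ℓ ≤ p * f S.toFinset + (p - 1) * E := by
      refine (Finset.sum_le_sum fun ℓ _ => h3 ℓ).trans ?_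
      simp only [List.map_append, List.sum_append, Finset.sum_add_distrib]
      exact add_le_add (sum_entries_le hS (h0 ∅)) hc.sink_sum
    have e3 : (R.card : ℝ) ≤ k := by
      exact_mod_cast (Finset.card_le_card Finset.sdiff_subset).trans hk
    have e4 := mul_le_mul_of_nonneg_left e2 (by linarith : 0 ≤ 1 + β)
    have e5 := mul_le_mul_of_nonneg_right e3 hα.le
    linarith
  -- The coefficient of E is 1 from f(A) ≤ f(S) + E plus (1+β)(p-1) from the sinks; then βE ≤ f(S) -
  -- v₀ is used.
  have h5 : (p + β * (p - 1)) * E ≤ (p / β + p - 1) * (f S.toFinset - v₀) := by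
    have e : (p : ℝ) + β * (p - 1) = (p / β + p - 1) * β := by field_simp; ring
    rw [e, mul_assoc]
    refine mul_le_mul_of_nonneg_left (by linarith [hc.gain]) ?_
    have : 0 ≤ (p : ℝ) / β := by positivity
    linarith
  have e6 : (p * (1 + β) ^ 2 / β) * f S.toFinset
      = (1 + (1 + β) * p + (p / β + p - 1)) * f S.toFinset := by
    congr 1; field_simp; ring
  have h7 := hc.le_add
  rw [e6]
  linarith

end Certificate

/-! ### The invariant along a stream. -/

section process

variable {m : ℕ}

open Classical in
theorem mem_support_step {s t : List X × Finset X} (h : t ∈ (M.step f pick α β m x s).support) :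
    ∃ B, s.2 ⊆ B ∧ (M.Good f pick α β s.1 x → x ∈ B) ∧
      (∀ z ∈ B, z ∈ s.2 ∨ M.Good f pick α β s.1 z) ∧
      (t = (s.1, B) ∨ ∃ y ∈ B, t = (M.accept pick s.1 y,
        (B.erase y).filter fun z => M.Good f pick α β (M.accept pick s.1 y) z)) := by
  refine ⟨if M.Good f pick α β s.1 x then insert x s.2 else s.2, ?_, ?_, ?_, ?_⟩
  · split_ifs
    · exact Finset.subset_insert _ _
    · exact subset_rfl
  · intro h; simp [h]
  · intro z hz
    split_ifs at hz with hg
    · rcases Finset.mem_insert.1 hz with rfl | hz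
      · exact Or.inr hg
      · exact Or.inl hz
    · exact Or.inl hz
  · unfold step at h
    dsimp only at h
    split_ifs at h ⊢ with hg h1 h1
    all_goals first
    | (rw [PMF.mem_support_bind_iff] at h
       obtain ⟨y, hy, ht⟩ := h
       rw [PMF.mem_support_uniformOfFinset_iff] at hy
       rw [PMF.mem_support_pure_iff] at ht
       exact Or.inr ⟨y, hy, ht⟩)
    | (rw [PMF.mem_support_pure_iff] at h
       exact Or.inl h)

/-- The body of the loop, keeping track of the set of all elements ever belonging to the current
solution. -/
def trackedStep (M : Matchoid X ι p) (f : Finset X → ℝ) (pick : ι → X → List X → X) (α β : ℝ)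
    (m : ℕ) (x : X) (s : (List X × Finset X) × Finset X) :
    PMF ((List X × Finset X) × Finset X) :=
  (M.step f pick α β m x s.1).map fun t => (t, s.2 ∪ t.1.toFinset)

/-- The loop, keeping track of the set of all elements ever belonging to the current solution. -/
def trackedRun (M : Matchoid X ι p) (f : Finset X → ℝ) (pick : ι → X → List X → X) (α β : ℝ)
    (m : ℕ) : List X → (List X × Finset X) × Finset X → PMF ((List X × Finset X) × Finset X)
  | [], s => PMF.pure s
  | x :: xs, s => (M.trackedStep f pick α β m x s).bind (M.trackedRun f pick α β m xs)

/-- Recording the history does not alter the law of the algorithm. -/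
theorem map_fst_trackedRun (xs : List X) (s : (List X × Finset X) × Finset X) :
    (M.trackedRun f pick α β m xs s).map Prod.fst = M.runStream f pick α β m xs s.1 := by
  induction xs generalizing s with
  | nil => simp [trackedRun, runStream, PMF.pure_map]
  | cons x xs ih =>
    rw [trackedRun, runStream, PMF.map_bind, trackedStep, PMF.bind_map]
    simp only [Function.comp_def, ih]

/-- The invariant of the loop. -/
def Invariant (M : Matchoid X ι p) (f : Finset X → ℝ) (pick : ι → X → List X → X) (α β v₀ : ℝ)
    (O : Finset X) (seen : Set X) (s : (List X × Finset X) × Finset X) : Prop :=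
  M.Valid f s.1.1 ∧ (∀ z ∈ s.1.2, M.Good f pick α β s.1.1 z) ∧
    ∃ E sink, M.Certificate f α β v₀ O seen s.1.1 s.1.2 s.2 E sink

theorem Invariant.trackedStep (hf : IsSubmodular f) (hp : M.IsArgminRule f pick)
    (hα : 0 < α) (hβ : 0 ≤ β) {v₀ : ℝ} {O : Finset X} (hO : M.Indep O) {seen : Set X}
    {s t : (List X × Finset X) × Finset X} (hs : M.Invariant f pick α β v₀ O seen s)
    (ht : t ∈ (M.trackedStep f pick α β m x s).support) :
    M.Invariant f pick α β v₀ O (insert x seen) t := by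
  classical
  obtain ⟨hV, hB, E, sink, hc⟩ := hs
  obtain ⟨t', ht', rfl⟩ := (PMF.mem_support_map_iff _ _ _).1 ht
  obtain ⟨B, h1, h2, h3, h4⟩ := mem_support_step ht'
  have hB' : ∀ z ∈ B, M.Good f pick α β s.1.1 z := fun z hz => (h3 z hz).elim (hB z) id
  have hc' := hc.arrive hf hV hp hβ hO h1 h2
  rcases h4 with rfl | ⟨y, hy, rfl⟩
  · refine ⟨hV, hB', E, sink, ?_⟩
    rwa [Finset.union_eq_left.2 hc.subset]
  · refine ⟨hV.accept hf (hB' y hy) hp hα hβ, fun z hz => (Finset.mem_filter.1 hz).2, _, _,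
      hc'.accept hf hV hp hα hβ hO (hB' y hy) ?_⟩
    intro z hz hzy hzg
    exact Finset.mem_filter.2 ⟨Finset.mem_erase.2 ⟨hzy, hz⟩, hzg⟩

theorem Invariant.trackedRun (hf : IsSubmodular f) (hp : M.IsArgminRule f pick)
    (hα : 0 < α) (hβ : 0 ≤ β) {v₀ : ℝ} {O : Finset X} (hO : M.Indep O) (xs : List X)
    {seen : Set X} {s t : (List X × Finset X) × Finset X}
    (hs : M.Invariant f pick α β v₀ O seen s)
    (ht : t ∈ (M.trackedRun f pick α β m xs s).support) :
    M.Invariant f pick α β v₀ O (seen ∪ {z | z ∈ xs}) t := by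
  induction xs generalizing s seen with
  | nil =>
    rw [Matchoid.trackedRun, PMF.mem_support_pure_iff] at ht
    subst ht
    simpa using hs
  | cons x xs ih =>
    rw [Matchoid.trackedRun, PMF.mem_support_bind_iff] at ht
    obtain ⟨u, hu, ht⟩ := ht
    have := ih (hs.trackedStep hf hp hα hβ hO hu) ht
    convert this using 1
    ext z
    simp only [Set.mem_union, Set.mem_ofPred_eq, List.mem_cons, Set.mem_insert_iff]
    tauto

end process

end Matchoid

/-! ### Independence, and the probability of touching an element. -/

namespace Matchoid

variable {X ι : Type*} {p : ℕ} {M : Matchoid X ι p} [DecidableEq X] {f : Finset X → ℝ}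
  {pick : ι → X → List X → X} {α β : ℝ} {S : List X} {x y : X} [Fintype ι] {m : ℕ}

theorem indep_empty (M : Matchoid X ι p) : M.Indep ∅ := fun ℓ => by simp

/-- Only the swap property is used, so that independence also holds when α = 0, where preservation
of `Valid` is not available. -/
theorem indep_of_mem_support_runStream (hp : M.IsArgminRule f pick) (xs : List X)
    {s t : List X × Finset X} (hs : M.Indep s.1.toFinset)
    (hB : ∀ z ∈ s.2, M.Good f pick α β s.1 z)
    (ht : t ∈ (M.runStream f pick α β m xs s).support) : M.Indep t.1.toFinset := by
  classical
  induction xs generalizing s with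
  | nil =>
    rw [runStream, PMF.mem_support_pure_iff] at ht
    rwa [ht]
  | cons x xs ih =>
    rw [runStream, PMF.mem_support_bind_iff] at ht
    obtain ⟨u, hu, ht⟩ := ht
    obtain ⟨B, -, -, h3, h4⟩ := mem_support_step hu
    have hB' : ∀ z ∈ B, M.Good f pick α β s.1 z := fun z hz => (h3 z hz).elim (hB z) id
    rcases h4 with rfl | ⟨y, hy, rfl⟩
    · exact ih (s := (s.1, B)) hs hB' ht
    · exact ih (indep_accept hs (hB' y hy) hp) (fun z hz => (Finset.mem_filter.1 hz).2) ht

open Classical in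
theorem lexpect_step_le (s : List X × Finset X) (g : List X × Finset X → ℝ) (hg : ∀ t, 0 ≤ g t)
    (r : ℝ) (h1 : ∀ B, g (s.1, B) ≤ r)
    (h2 : ∀ B : Finset X, B.Nonempty → B.card = m →
      (∀ z ∈ B, z ∈ s.2 ∨ M.Good f pick α β s.1 z) →
      (∑ y ∈ B, g (M.accept pick s.1 y,
        (B.erase y).filter fun z => M.Good f pick α β (M.accept pick s.1 y) z)) / m ≤ r) :
    lexpect (M.step f pick α β m x s) (fun t => ENNReal.ofReal (g t)) ≤ ENNReal.ofReal r := by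
  have hB : ∀ z ∈ (if M.Good f pick α β s.1 x then insert x s.2 else s.2),
      z ∈ s.2 ∨ M.Good f pick α β s.1 z := by
    intro z hz
    split_ifs at hz with hg
    · rcases Finset.mem_insert.1 hz with rfl | hz
      · exact Or.inr hg
      · exact Or.inl hz
    · exact Or.inl hz
  have key : ∀ B : Finset X, (∀ z ∈ B, z ∈ s.2 ∨ M.Good f pick α β s.1 z) →
      lexpect (if h : B.Nonempty ∧ B.card = m then
        (PMF.uniformOfFinset B h.1).bind fun y => PMF.pure (M.accept pick s.1 y,
          (B.erase y).filter fun z => M.Good f pick α β (M.accept pick s.1 y) z)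
        else PMF.pure (s.1, B)) (fun t => ENNReal.ofReal (g t)) ≤ ENNReal.ofReal r := by
    intro B hB
    split_ifs with h
    · rw [lexpect_bind]
      simp only [lexpect_pure]
      rw [lexpect_uniformOfFinset _ _ (fun y => g (M.accept pick s.1 y, _)) (fun _ _ => hg _), h.2]
      exact ENNReal.ofReal_le_ofReal (h2 _ h.1 h.2 hB)
    · rw [lexpect_pure]
      exact ENNReal.ofReal_le_ofReal (h1 _)
  exact key _ hB

/-- A bound for the expected number of future acceptances of `x`, for solutions of value at most
`V`. -/
def potential (f : Finset X → ℝ) (α : ℝ) (m : ℕ) (V : ℝ) (x : X)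
    (s : (List X × Finset X) × Finset X) : ℝ :=
  (if x ∈ s.2 then 1 else 0) + (max 0 (V - f s.1.1.toFinset)) / (α * m)

theorem potential_nonneg (hα : 0 ≤ α) (V : ℝ) (x : X) (s : (List X × Finset X) × Finset X) :
    0 ≤ potential f α m V x s := by
  unfold potential
  have : (0 : ℝ) ≤ if x ∈ s.2 then 1 else 0 := by split_ifs <;> norm_num
  have := div_nonneg (le_max_left 0 (V - f s.1.1.toFinset))
    (mul_nonneg hα (Nat.cast_nonneg m : (0 : ℝ) ≤ m))
  linarith

/-- The potential is a supermartingale: an acceptance hits z with probability at most 1/m, and the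
gap V - f(S) falls by at least α, which lowers the second term by at least 1/m. -/
theorem lexpect_potential_trackedStep_le (hf : IsSubmodular f) (hp : M.IsArgminRule f pick)
    (hα : 0 < α) (hβ : 0 ≤ β) {v₀ V : ℝ} (hV : ∀ T, M.Indep T → f T ≤ V) {O : Finset X}
    {seen : Set X} {s : (List X × Finset X) × Finset X}
    (hs : M.Invariant f pick α β v₀ O seen s) (z : X) :
    lexpect (M.trackedStep f pick α β m x s) (fun t => ENNReal.ofReal (potential f α m V z t))
      ≤ ENNReal.ofReal (potential f α m V z s) := by
  obtain ⟨hVS, hB, E, sink, hc⟩ := hs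
  rw [trackedStep, lexpect_map]
  refine lexpect_step_le s.1 (fun t => potential f α m V z (t, s.2 ∪ t.1.toFinset))
    (fun t => potential_nonneg hα.le _ _ _) _ (fun B => ?_) (fun B hne hcard hBg => ?_)
  · simp only [potential]
    rw [Finset.union_eq_left.2 hc.subset]
  · have hm : (0 : ℝ) < m := by rw [← hcard]; exact_mod_cast hne.card_pos
    have hg : ∀ y ∈ B, M.Good f pick α β s.1.1 y := fun y hy => (hBg y hy).elim (hB y) id
    have hfS := hV _ hVS.indep
    rw [div_le_iff₀ hm]
    have h1 : ∀ y ∈ B, ∀ B', potential f α m V z ((M.accept pick s.1.1 y, B'),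
        s.2 ∪ (M.accept pick s.1.1 y).toFinset)
        ≤ (if z ∈ s.2 then 1 else 0) + (if z = y then 1 else 0)
          + (V - f s.1.1.toFinset - α) / (α * m) := by
      intro y hy B'
      have h2 := hVS.le_accept hf (hg y hy) hp hα hβ
      have h3 := mul_nonneg hβ (hVS.sum_exchange_nonneg (hg y hy) hp)
      have h4 := hV _ (hVS.accept hf (hg y hy) hp hα hβ).indep
      unfold potential
      refine add_le_add ?_ ?_
      · by_cases hz : z ∈ s.2
        · simp [hz]
          split_ifs <;> norm_num
        · by_cases hzy : z = y
          · simp [hzy]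
            split_ifs <;> norm_num
          · have : z ∉ M.accept pick s.1.1 y := by
              rw [mem_accept]
              rintro (h | ⟨h, _⟩)
              · exact hzy h
              · exact hz (hc.subset (List.mem_toFinset.2 h))
            simp [hz, hzy, this]
      · refine div_le_div_of_nonneg_right ?_ (by positivity)
        dsimp only
        exact max_le (by linarith) (by linarith)
    refine (Finset.sum_le_sum fun y hy => h1 y hy _).trans ?_
    rw [Finset.sum_add_distrib, Finset.sum_add_distrib, Finset.sum_const, Finset.sum_const,
      Finset.sum_ite_eq, nsmul_eq_mul, nsmul_eq_mul, hcard]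
    unfold potential
    rw [max_eq_right (by linarith)]
    -- Over the m outcomes the decrease totals exactly 1, which pays for the single outcome y = z.
    have e : (m : ℝ) * ((V - f s.1.1.toFinset - α) / (α * m))
        = (V - f s.1.1.toFinset) / (α * m) * m - 1 := by field_simp
    rw [e, add_mul]
    have : (if z ∈ B then (1 : ℝ) else 0) ≤ 1 := by split_ifs <;> norm_num
    linarith

theorem lexpect_potential_trackedRun_le (hf : IsSubmodular f) (hp : M.IsArgminRule f pick)
    (hα : 0 < α) (hβ : 0 ≤ β) {v₀ V : ℝ} (hV : ∀ T, M.Indep T → f T ≤ V) {O : Finset X}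
    (hO : M.Indep O) (xs : List X) {seen : Set X} {s : (List X × Finset X) × Finset X}
    (hs : M.Invariant f pick α β v₀ O seen s) (z : X) :
    lexpect (M.trackedRun f pick α β m xs s) (fun t => ENNReal.ofReal (potential f α m V z t))
      ≤ ENNReal.ofReal (potential f α m V z s) := by
  induction xs generalizing s seen with
  | nil => rw [trackedRun, lexpect_pure]
  | cons x xs ih =>
    rw [trackedRun, lexpect_bind]
    refine le_trans (lexpect_mono fun t ht => ?_)
      (lexpect_potential_trackedStep_le (x := x) (m := m) hf hp hα hβ hV hs z)
    exact ih (hs.trackedStep hf hp hα hβ hO ht)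

/-! ### Composition of passes. -/

section multipass

variable {off : Finset X → PMF (Finset X)} {stream : ℕ → List X} {β : ℕ → ℝ}

theorem mem_support_multipass_succ {i : ℕ} {u : List X × Finset X}
    (hu : u ∈ (M.multipass f pick off stream α β m (i + 1)).support) :
    ∃ s ∈ (M.multipass f pick off stream α β m i).support,
      ∃ t ∈ (M.runStream f pick α (β (i + 1)) m (stream (i + 1)) (s.1, ∅)).support,
        ∃ T ∈ (off t.2).support, u = (t.1, if f s.2 ≤ f T then T else s.2) := by
  rw [multipass, PMF.mem_support_bind_iff] at hu
  obtain ⟨s, hs, hu⟩ := hu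
  obtain ⟨r, hr, rfl⟩ := (PMF.mem_support_map_iff _ _ _).1 hu
  rw [randomizedLocalSearch, PMF.mem_support_bind_iff] at hr
  obtain ⟨t, ht, hr⟩ := hr
  obtain ⟨T, hT, rfl⟩ := (PMF.mem_support_map_iff _ _ _).1 hr
  exact ⟨s, hs, t, ht, T, hT, rfl⟩

theorem indep_of_mem_support_multipass (hp : M.IsArgminRule f pick)
    (hoff : ∀ B, ∀ T ∈ (off B).support, M.Indep T) (i : ℕ) {u : List X × Finset X}
    (hu : u ∈ (M.multipass f pick off stream α β m i).support) :
    M.Indep u.1.toFinset ∧ M.Indep u.2 := by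
  induction i generalizing u with
  | zero =>
    rw [multipass, PMF.mem_support_pure_iff] at hu
    subst hu
    exact ⟨M.indep_empty, M.indep_empty⟩
  | succ i ih =>
    obtain ⟨s, hs, t, ht, T, hT, rfl⟩ := mem_support_multipass_succ hu
    obtain ⟨h1, h2⟩ := ih hs
    refine ⟨indep_of_mem_support_runStream (s := (s.1, ∅)) (t := t) hp _ h1
      (fun z hz => absurd hz (Finset.notMem_empty z)) ht, ?_⟩
    dsimp only
    split_ifs
    · exact hoff _ _ hT
    · exact h2

theorem indep_of_mem_support_output (hp : M.IsArgminRule f pick)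
    (hoff : ∀ B, ∀ T ∈ (off B).support, M.Indep T) (d : ℕ) {T : Finset X}
    (hT : T ∈ (M.output f pick off stream α β m d).support) : M.Indep T := by
  obtain ⟨u, hu, rfl⟩ := (PMF.mem_support_map_iff _ _ _).1 hT
  obtain ⟨h1, h2⟩ := indep_of_mem_support_multipass hp hoff d hu
  split_ifs
  · exact h1
  · exact h2

theorem invariant_init (hV : M.Valid f S) (β : ℝ) (O : Finset X) :
    M.Invariant f pick α β (f S.toFinset) O ∅ ((S, ∅), S.toFinset) :=
  ⟨hV, by simp, 0, _, Certificate.init M f α β O S⟩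

theorem valid_of_mem_support_multipass (hf : IsSubmodular f) (hp : M.IsArgminRule f pick)
    (hα : 0 < α) (hβ : ∀ i, 0 ≤ β (i + 1)) (i : ℕ)
    {u : List X × Finset X} (hu : u ∈ (M.multipass f pick off stream α β m i).support) :
    M.Valid f u.1 := by
  induction i generalizing u with
  | zero =>
    rw [multipass, PMF.mem_support_pure_iff] at hu
    subst hu
    exact Valid.nil M f
  | succ i ih =>
    obtain ⟨s, hs, t, ht, T, hT, rfl⟩ := mem_support_multipass_succ hu
    rw [← map_fst_trackedRun _ ((s.1, ∅), s.1.toFinset), PMF.mem_support_map_iff] at ht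
    obtain ⟨r, hr, rfl⟩ := ht
    exact ((invariant_init (ih hs) _ ∅).trackedRun hf hp hα (hβ _) M.indep_empty _ hr).1

theorem lexpect_multipass_succ (i : ℕ) (g : List X × Finset X → ENNReal) :
    lexpect (M.multipass f pick off stream α β m (i + 1)) g
      = lexpect (M.multipass f pick off stream α β m i) fun s =>
        lexpect (M.trackedRun f pick α (β (i + 1)) m (stream (i + 1)) ((s.1, ∅), s.1.toFinset))
          fun t => lexpect (off t.1.2) fun T => g (t.1.1, if f s.2 ≤ f T then T else s.2) := by
  rw [multipass, lexpect_bind]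
  congr 1
  funext s
  rw [lexpect_map, randomizedLocalSearch, lexpect_bind,
    ← map_fst_trackedRun _ ((s.1, ∅), s.1.toFinset), lexpect_map]
  simp only [lexpect_map]

/-- The law of the set of all elements belonging to the current solution at some point of the
pass after the `i`-th one. -/
def touched (M : Matchoid X ι p) (f : Finset X → ℝ) (pick : ι → X → List X → X)
    (off : Finset X → PMF (Finset X)) (stream : ℕ → List X) (α : ℝ) (β : ℕ → ℝ) (m i : ℕ) :
    PMF (Finset X) :=
  (M.multipass f pick off stream α β m i).bind fun s =>
    (M.trackedRun f pick α (β (i + 1)) m (stream (i + 1)) ((s.1, ∅), s.1.toFinset)).map Prod.snd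

theorem lexpect_touched (i : ℕ) (g : Finset X → ENNReal) :
    lexpect (M.touched f pick off stream α β m i) g
      = lexpect (M.multipass f pick off stream α β m i) fun s =>
        lexpect (M.trackedRun f pick α (β (i + 1)) m (stream (i + 1)) ((s.1, ∅), s.1.toFinset))
          fun t => g t.2 := by
  simp only [touched, lexpect_bind, lexpect_map]

theorem lexpect_mem_touched_le (hf : IsSubmodular f) (h0 : ∀ T, 0 ≤ f T)
    (hp : M.IsArgminRule f pick)
    (hα : 0 < α) (hβ : ∀ i, 0 ≤ β (i + 1)) {V : ℝ} (hV : ∀ T, M.Indep T → f T ≤ V) (i : ℕ) (z : X) :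
    lexpect (M.touched f pick off stream α β m i)
        (fun A => ENNReal.ofReal (if z ∈ A then 1 else 0))
      ≤ lexpect (M.multipass f pick off stream α β m i)
          (fun s => ENNReal.ofReal (if z ∈ s.1.toFinset then 1 else 0))
        + ENNReal.ofReal (V / (α * m)) := by
  have hVn : 0 ≤ V := (h0 ∅).trans (hV ∅ M.indep_empty)
  have hq : 0 ≤ V / (α * m) := by positivity
  rw [lexpect_touched, ← lexpect_const (M.multipass f pick off stream α β m i)
    (ENNReal.ofReal (V / (α * m))), ← lexpect_add]
  refine lexpect_mono fun s hs => ?_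
  -- Only validity and S ⊆ A are needed here, so the certificate is taken for the empty set.
  have hI := invariant_init (α := α) (pick := pick)
    (valid_of_mem_support_multipass hf hp hα hβ i hs) (β (i + 1)) ∅
  have h1 := lexpect_potential_trackedRun_le (m := m) hf hp hα (hβ _) hV
    M.indep_empty (stream (i + 1)) hI z
  refine le_trans (lexpect_mono fun t _ => ENNReal.ofReal_le_ofReal ?_) (h1.trans ?_)
  · unfold potential
    have := div_nonneg (le_max_left 0 (V - f t.1.1.toFinset))
      (mul_nonneg hα.le (Nat.cast_nonneg m : (0 : ℝ) ≤ m))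
    linarith
  · rw [← ENNReal.ofReal_add (by split_ifs <;> norm_num) hq]
    refine ENNReal.ofReal_le_ofReal ?_
    unfold potential
    have := div_le_div_of_nonneg_right (max_le hVn (by linarith [h0 s.1.toFinset]) :
      max 0 (V - f s.1.toFinset) ≤ V) (mul_nonneg hα.le (Nat.cast_nonneg m : (0 : ℝ) ≤ m))
    dsimp only
    linarith

/-- The solution after a pass lies in the set touched during it, so each pass adds at most V/(αm).
-/
theorem lexpect_mem_multipass_le (hf : IsSubmodular f) (h0 : ∀ T, 0 ≤ f T)
    (hp : M.IsArgminRule f pick)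
    (hα : 0 < α) (hβ : ∀ i, 0 ≤ β (i + 1)) {V : ℝ} (hV : ∀ T, M.Indep T → f T ≤ V) (i : ℕ) (z : X) :
    lexpect (M.multipass f pick off stream α β m i)
        (fun s => ENNReal.ofReal (if z ∈ s.1.toFinset then 1 else 0))
      ≤ ENNReal.ofReal (i * (V / (α * m))) := by
  have hVn : 0 ≤ V := (h0 ∅).trans (hV ∅ M.indep_empty)
  have hq : 0 ≤ V / (α * m) := by positivity
  induction i with
  | zero => simp [multipass, lexpect_pure]
  | succ i ih =>
    have h1 := (lexpect_mem_touched_le (off := off) (stream := stream) (m := m)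
      hf h0 hp hα hβ hV i z).trans (add_le_add_left ih _)
    rw [← ENNReal.ofReal_add (by positivity) hq] at h1
    push_cast
    rw [add_mul, one_mul]
    refine le_trans ?_ h1
    rw [lexpect_multipass_succ, lexpect_touched]
    refine lexpect_mono fun s hs => lexpect_mono fun t ht => ?_
    refine (lexpect_const (off t.1.2)
      (ENNReal.ofReal (if z ∈ t.1.1.toFinset then 1 else 0))).le.trans ?_
    refine ENNReal.ofReal_le_ofReal ?_
    have hI := (invariant_init (α := α) (pick := pick)
      (valid_of_mem_support_multipass hf hp hα hβ i hs) (β (i + 1)) ∅).trackedRun hf hp hα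
      (hβ _) M.indep_empty _ ht
    obtain ⟨-, -, E, sink, hc⟩ := hI
    split_ifs with h1 h2 h2
    · exact le_rfl
    · exact absurd (hc.subset h1) h2
    · norm_num
    · exact le_rfl

theorem expect_mem_touched_le [Fintype X] (hf : IsSubmodular f) (h0 : ∀ T, 0 ≤ f T)
    (hp : M.IsArgminRule f pick)
    (hα : 0 < α) (hβ : ∀ i, 0 ≤ β (i + 1)) {V : ℝ} (hV : ∀ T, M.Indep T → f T ≤ V) (i : ℕ) (z : X) :
    expect (M.touched f pick off stream α β m i) (fun A => if z ∈ A then 1 else 0)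
      ≤ (i + 1) * (V / (α * m)) := by
  have hVn : 0 ≤ V := (h0 ∅).trans (hV ∅ M.indep_empty)
  have hq : 0 ≤ V / (α * m) := by positivity
  rw [← ENNReal.ofReal_le_ofReal_iff (by positivity), ofReal_expect _ fun A => by
    split_ifs <;> norm_num]
  refine (lexpect_mem_touched_le hf h0 hp hα hβ hV i z).trans ?_
  refine (add_le_add_left (lexpect_mem_multipass_le hf h0 hp hα hβ hV i z) _).trans ?_
  rw [← ENNReal.ofReal_add (by positivity) hq, add_mul, one_mul]

theorem expect_solS'_mono [Fintype X] (h0 : ∀ T, 0 ≤ f T) (i : ℕ) :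
    expect (M.solS' f pick off stream α β m i) f
      ≤ expect (M.solS' f pick off stream α β m (i + 1)) f := by
  rw [← ENNReal.ofReal_le_ofReal_iff (expect_nonneg _ h0), solS', solS', ofReal_expect_map _ _ h0,
    ofReal_expect_map _ _ h0, lexpect_multipass_succ]
  refine lexpect_mono fun s _ => ?_
  rw [← lexpect_const (M.trackedRun f pick α (β (i + 1)) m (stream (i + 1))
    ((s.1, ∅), s.1.toFinset)) (ENNReal.ofReal (f s.2))]
  refine lexpect_mono fun t _ => ?_
  rw [← lexpect_const (off t.1.2) (ENNReal.ofReal (f s.2))]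
  refine lexpect_mono fun T _ => ENNReal.ofReal_le_ofReal ?_
  split_ifs with h
  · exact h
  · exact le_rfl

/-- The progress of one pass. -/
theorem expect_pass_le [Fintype X] (hf : IsSubmodular f) (h0 : ∀ T, 0 ≤ f T)
    (hp : M.IsArgminRule f pick) (hp1 : 1 ≤ p) (hα : 0 < α) (hβ : ∀ i, 0 < β (i + 1))
    {γ : ℝ} (hγ : 0 ≤ γ) (hoff : M.IsOfflineApprox f γ off)
    {O : Finset X} (hO : M.Indep O) {k : ℕ} (hk : O.card ≤ k) (i : ℕ)
    (hstream : ∀ x, x ∈ stream (i + 1)) :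
    expect (M.touched f pick off stream α β m i) (fun A => f (O ∪ A))
      + (p / β (i + 1) + p - 1) * expect (M.solS f pick off stream α β m i) f
      ≤ k * α + (p * (1 + β (i + 1)) ^ 2 / β (i + 1)) *
          expect (M.solS f pick off stream α β m (i + 1)) f
        + γ * expect (M.solS' f pick off stream α β m (i + 1)) f := by
  have hp' : (1 : ℝ) ≤ p := by exact_mod_cast hp1
  set b := β (i + 1) with hb
  have hb0 : 0 < b := hβ _
  have hc : 0 ≤ p / b + p - 1 := by
    have : 0 ≤ (p : ℝ) / b := by positivity
    linarith
  have hD : 0 ≤ p * (1 + b) ^ 2 / b := by positivity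
  have hkα : 0 ≤ k * α := by positivity
  have n1 := expect_nonneg (M.touched f pick off stream α β m i) (g := fun A => f (O ∪ A))
    fun A => h0 _
  have n2 := expect_nonneg (M.solS f pick off stream α β m i) h0
  have n3 := expect_nonneg (M.solS f pick off stream α β m (i + 1)) h0
  have n4 := expect_nonneg (M.solS' f pick off stream α β m (i + 1)) h0
  have m2 := mul_nonneg hc n2
  have m3 := mul_nonneg hD n3
  have m4 := mul_nonneg hγ n4
  rw [← ENNReal.ofReal_le_ofReal_iff (by linarith), ENNReal.ofReal_add n1 m2,
    ENNReal.ofReal_add (by linarith) m4, ENNReal.ofReal_add hkα m3, ENNReal.ofReal_mul hc,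
    ENNReal.ofReal_mul hD, ENNReal.ofReal_mul hγ, ofReal_expect _ (fun A => h0 (O ∪ A)),
    solS, solS, solS', ofReal_expect_map _ _ h0, ofReal_expect_map _ _ h0,
    ofReal_expect_map _ _ h0, lexpect_touched, lexpect_multipass_succ, lexpect_multipass_succ,
    ← lexpect_const_mul, ← lexpect_const_mul, ← lexpect_const_mul,
    ← lexpect_const (M.multipass f pick off stream α β m i) (ENNReal.ofReal (k * α)),
    ← lexpect_add, ← lexpect_add, ← lexpect_add]
  refine lexpect_mono fun s hs => ?_
  set Q := M.trackedRun f pick α (β (i + 1)) m (stream (i + 1)) ((s.1, ∅), s.1.toFinset) with hQ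
  rw [← lexpect_const Q (ENNReal.ofReal (p / b + p - 1) * ENNReal.ofReal (f s.1.toFinset)),
    ← lexpect_const Q (ENNReal.ofReal (k * α)), ← lexpect_const_mul, ← lexpect_const_mul,
    ← lexpect_add, ← lexpect_add, ← lexpect_add]
  refine lexpect_mono fun t ht => ?_
  have hI := (invariant_init (α := α) (pick := pick)
    (valid_of_mem_support_multipass hf hp hα (fun i => (hβ i).le) i hs) (β (i + 1)) O).trackedRun
    hf hp hα hb0.le hO _ ht
  obtain ⟨hV, -, E, sink, hcert⟩ := hI
  have h1 := hcert.bound hf h0 hV hα hb0 hO hk hp1 (fun x _ => Or.inr (hstream x))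
  -- O ∩ B is a feasible solution inside the buffer B, so the offline result pays for it.
  have h2 := (hoff t.1.2).2 (O ∩ t.1.2) Finset.inter_subset_right
    (hO.subset Finset.inter_subset_left)
  have n5 := expect_nonneg (off t.1.2) h0
  have h3 := ENNReal.ofReal_le_ofReal (h1.trans (add_le_add_right h2 _))
  rw [ENNReal.ofReal_add (h0 _) (mul_nonneg hc (h0 _)), ENNReal.ofReal_mul hc,
    ENNReal.ofReal_add (add_nonneg hkα (mul_nonneg hD (h0 _))) (mul_nonneg hγ n5),
    ENNReal.ofReal_add hkα (mul_nonneg hD (h0 _)), ENNReal.ofReal_mul hD,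
    ENNReal.ofReal_mul hγ, ofReal_expect _ h0] at h3
  refine h3.trans ?_
  dsimp only
  rw [lexpect_const]
  gcongr
  refine lexpect_mono fun T _ => ENNReal.ofReal_le_ofReal ?_
  split_ifs with h
  · exact le_rfl
  · exact (not_le.1 h).le

end multipass

end Matchoid

/-! ### The recursion over passes. -/

namespace Matchoid

variable {X ι : Type*} [Fintype X] [DecidableEq X] [Fintype ι] {p : ℕ} {M : Matchoid X ι p}
  {f : Finset X → ℝ} {pick : ι → X → List X → X} {off : Finset X → PMF (Finset X)}
  {stream : ℕ → List X} {β : ℕ → ℝ} {α ε γ : ℝ} {d k m : ℕ} {O : Finset X}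

theorem pass_factor_one (p : ℕ) : (p : ℝ) * (1 + betaSeq p 1) ^ 2 / betaSeq p 1 = gammaSeq p 1 := by
  simp [betaSeq, gammaSeq]
  ring

/-- The recursion of the approximation factors: `(1 + c / γ_i) γ_{i+1} = p (1 + β)² / β` with
`c = p / β + p - 1` and `β = β_{i+1}`. -/
theorem pass_factor_succ (hp1 : 1 ≤ p) {i : ℕ} (hi : 1 ≤ i) :
    (gammaSeq p i + (p / betaSeq p (i + 1) + p - 1)) * gammaSeq p (i + 1)
      = gammaSeq p i * (p * (1 + betaSeq p (i + 1)) ^ 2 / betaSeq p (i + 1)) := by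
  have hp' : (1 : ℝ) ≤ p := by exact_mod_cast hp1
  have hlt := lt_gammaSeq p hp1 i hi
  rw [gammaSeq_succ p i hi]
  have hb : betaSeq p (i + 1) = (gammaSeq p i - 1 - p) / (gammaSeq p i - 1 + p) := by
    rw [betaSeq, if_neg (by omega), Nat.add_sub_cancel]
  rw [hb]
  obtain ⟨u, hu⟩ : ∃ u, gammaSeq p i = u + p + 1 := ⟨gammaSeq p i - p - 1, by ring⟩
  have hu0 : 0 < u := by linarith
  rw [hu, show u + p + 1 - 1 - (p : ℝ) = u by ring, show u + p + 1 - 1 + (p : ℝ) = u + 2 * p by ring,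
    show u + p + 1 - 1 = u + (p : ℝ) by ring]
  have : 0 < u + 2 * p := by linarith
  field_simp
  ring

theorem le_expect_pass_of_pos (hf : IsSubmodular f) (h0 : ∀ T, 0 ≤ f T)
    (hp : M.IsArgminRule f pick) (hp1 : 1 ≤ p) (hβ : ∀ i, 1 ≤ i → β i = betaSeq p i)
    (hγ : 1 ≤ γ) (hoff : M.IsOfflineApprox f γ off) (hε : 0 < ε)
    (hO : M.IsOpt f O) (hk : O.card ≤ k) (hk0 : 0 < k) (hfO : 0 < f O)
    (hα : α = ε * f O / (2 * k)) (hm : m = bufferSize d k ε)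
    (hstream : ∀ i x, x ∈ stream i) {i : ℕ} (hi : 1 ≤ i) (hid : i ≤ d) :
    (1 - ε) * f O ≤ gammaSeq p i * expect (M.solS f pick off stream α β m i) f
      + γ * expect (M.solS' f pick off stream α β m i) f := by
  have hα0 : 0 < α := by rw [hα]; positivity
  have hβ0 : ∀ i, 0 < β (i + 1) := fun i => by
    rw [hβ _ (Nat.le_add_left 1 i)]; exact betaSeq_pos p hp1 _
  have hkα : k * α = ε / 2 * f O := by
    rw [hα]; field_simp
  -- The sampling lemma is applied to this function, whose value at the empty set is f(O).
  have hsub : IsSubmodular fun A => f (O ∪ A) := fun A B => by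
    have h := hf (O ∪ A) (O ∪ B)
    rwa [← Finset.union_union_distrib_left, ← Finset.union_inter_distrib_left] at h
  -- The choice of m gives αm ≥ 2d f(O)/ε, hence a probability of at most ε/(2d) per pass.
  have hprob : ∀ j : ℕ, j + 1 ≤ d → ((j : ℝ) + 1) * (f O / (α * m)) ≤ ε / 2 := by
    intro j hj
    have hd : (0 : ℝ) < d := by exact_mod_cast (Nat.succ_pos j).trans_le hj
    have hj' : (j : ℝ) + 1 ≤ d := by exact_mod_cast hj
    have hk0' : (0 : ℝ) < k := by exact_mod_cast hk0
    have hm' : 4 * d * k / ε ^ 2 ≤ (m : ℝ) := by rw [hm]; exact Nat.le_ceil _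
    have hm0 : (0 : ℝ) < m := (by positivity : (0 : ℝ) < 4 * d * k / ε ^ 2).trans_le hm'
    have h1 : 2 * d * f O / ε ≤ α * m := by
      refine le_trans (le_of_eq ?_) (mul_le_mul_of_nonneg_left hm' hα0.le)
      rw [hα]
      field_simp
      ring
    rw [← mul_div_assoc, div_le_iff₀ (by positivity)]
    have h2 := mul_le_mul_of_nonneg_left h1 (by positivity : 0 ≤ ε / 2)
    have h3 : ε / 2 * (2 * d * f O / ε) = d * f O := by field_simp
    have h4 := mul_le_mul_of_nonneg_right hj' hfO.le
    linarith
  -- The loss ε is split evenly between kα and the sampling lemma.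
  have hpass : ∀ j : ℕ, j + 1 ≤ d →
      (1 - ε) * f O + (p / betaSeq p (j + 1) + p - 1) *
          expect (M.solS f pick off stream α β m j) f
        ≤ (p * (1 + betaSeq p (j + 1)) ^ 2 / betaSeq p (j + 1)) *
          expect (M.solS f pick off stream α β m (j + 1)) f
        + γ * expect (M.solS' f pick off stream α β m (j + 1)) f := by
    intro j hj
    have h1 := expect_pass_le (off := off) (stream := stream) (m := m) hf h0 hp hp1 hα0 hβ0
      (by linarith : 0 ≤ γ) hoff hO.1 hk j (hstream (j + 1))
    have h2 := hsub.expect_ge (fun A => h0 _) (M.touched f pick off stream α β m j) (ε / 2)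
      (by positivity) fun x => (expect_mem_touched_le hf h0 hp hα0 (fun i => (hβ0 i).le)
        hO.2 j x).trans (hprob j hj)
    rw [Finset.union_empty] at h2
    rw [hβ _ (Nat.le_add_left 1 j)] at h1
    linarith
  have hp' : (1 : ℝ) ≤ p := by exact_mod_cast hp1
  have hc : ∀ j, 0 ≤ (p : ℝ) / betaSeq p j + p - 1 := fun j => by
    have := div_nonneg (Nat.cast_nonneg p : (0 : ℝ) ≤ p) (betaSeq_pos p hp1 j).le
    linarith
  induction i, hi using Nat.le_induction with
  | base =>
    have h1 := hpass 0 hid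
    rw [zero_add, pass_factor_one] at h1
    have := mul_nonneg (hc 1) (expect_nonneg (M.solS f pick off stream α β m 0) h0)
    linarith
  | succ i hi ih =>
    have h1 := ih (by omega)
    have h2 := hpass i hid
    have h3 := mul_le_mul_of_nonneg_left (expect_solS'_mono (M := M) (pick := pick) (off := off)
      (stream := stream) (α := α) (β := β) (m := m) h0 i) (by linarith : 0 ≤ γ)
    have hγi := lt_gammaSeq p hp1 i hi
    have hfac := pass_factor_succ hp1 hi
    have hci := hc (i + 1)
    set c := (p : ℝ) / betaSeq p (i + 1) + p - 1
    set D := (p : ℝ) * (1 + betaSeq p (i + 1)) ^ 2 / betaSeq p (i + 1)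
    set e := expect (M.solS f pick off stream α β m i) f
    set e' := expect (M.solS f pick off stream α β m (i + 1)) f
    set b := γ * expect (M.solS' f pick off stream α β m (i + 1)) f
    -- The new offline value replaces the old one, as it is no smaller. The pass inequality times
    -- γ_i and this one times c then combine through `pass_factor_succ`.
    have h4 : (1 - ε) * f O - b ≤ gammaSeq p i * e := by linarith
    have h5 := mul_le_mul_of_nonneg_left h4 hci
    have h6 := mul_le_mul_of_nonneg_left h2 (by linarith : 0 ≤ gammaSeq p i)
    have h7 : (gammaSeq p i + c) * ((1 - ε) * f O - b)
        ≤ (gammaSeq p i + c) * (gammaSeq p (i + 1) * e') := by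
      rw [← mul_assoc, hfac]
      linarith
    have h8 := le_of_mul_le_mul_left h7 (by linarith)
    linarith

/-- If f(O) = 0 or k = 0 then α = 0 and the pass analysis does not apply. In the first case the left
side vanishes; in the second every solution is empty, hence optimal. -/
theorem le_expect_pass (hf : IsSubmodular f) (h0 : ∀ T, 0 ≤ f T)
    (hp : M.IsArgminRule f pick) (hp1 : 1 ≤ p) (hβ : ∀ i, 1 ≤ i → β i = betaSeq p i)
    (hγ : 1 ≤ γ) (hoff : M.IsOfflineApprox f γ off) (hε : 0 < ε)
    (hO : M.IsOpt f O) (hk : M.IsRank k)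
    (hα : α = ε * f O / (2 * k)) (hm : m = bufferSize d k ε)
    (hstream : ∀ i x, x ∈ stream i) {i : ℕ} (hi : 1 ≤ i) (hid : i ≤ d) :
    (1 - ε) * f O ≤ gammaSeq p i * expect (M.solS f pick off stream α β m i) f
      + γ * expect (M.solS' f pick off stream α β m i) f := by
  have hp' : (1 : ℝ) ≤ p := by exact_mod_cast hp1
  have hγi := lt_gammaSeq p hp1 i hi
  have hOk : O.card ≤ k := hk.2 ⟨O, hO.1, rfl⟩
  have n1 := expect_nonneg (M.solS f pick off stream α β m i) h0
  have n2 := expect_nonneg (M.solS' f pick off stream α β m i) h0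
  have n3 := mul_nonneg (by linarith : 0 ≤ γ) n2
  rcases (h0 O).eq_or_lt with hfO | hfO
  · rw [← hfO, mul_zero]
    have := mul_nonneg (by linarith : 0 ≤ gammaSeq p i) n1
    linarith
  rcases k.eq_zero_or_pos with rfl | hk0
  · have hempty : ∀ T, M.Indep T → T = ∅ := fun T hT =>
      Finset.card_eq_zero.1 (Nat.le_zero.1 (hk.2 ⟨T, hT, rfl⟩))
    have h1 : f O ≤ expect (M.solS f pick off stream α β m i) f := by
      rw [← ENNReal.ofReal_le_ofReal_iff n1, solS, ofReal_expect_map _ _ h0,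
        ← lexpect_const (M.multipass f pick off stream α β m i) (ENNReal.ofReal (f O))]
      refine lexpect_mono fun s hs => ?_
      rw [hempty _ (indep_of_mem_support_multipass hp
        (fun B T hT => ((hoff B).1 T hT).2) i hs).1, hempty O hO.1]
    have h2 := mul_le_mul hγi.le h1 hfO.le (by linarith)
    nlinarith
  · exact le_expect_pass_of_pos hf h0 hp hp1 hβ hγ hoff hε hO hOk hk0 hfO hα hm hstream hi hid

theorem max_le_expect_output (h0 : ∀ T, 0 ≤ f T) (i : ℕ) :
    expect (M.solS f pick off stream α β m i) f ≤ expect (M.output f pick off stream α β m i) f ∧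
    expect (M.solS' f pick off stream α β m i) f ≤ expect (M.output f pick off stream α β m i) f := by
  constructor
  all_goals
    rw [← ENNReal.ofReal_le_ofReal_iff (expect_nonneg _ h0), output, ofReal_expect_map _ _ h0]
    first
    | rw [solS, ofReal_expect_map _ _ h0]
    | rw [solS', ofReal_expect_map _ _ h0]
    refine lexpect_mono fun s _ => ENNReal.ofReal_le_ofReal ?_
    split_ifs with h <;> linarith

theorem le_expect_output (hf : IsSubmodular f) (h0 : ∀ T, 0 ≤ f T)
    (hp : M.IsArgminRule f pick) (hp1 : 1 ≤ p) (hβ : ∀ i, 1 ≤ i → β i = betaSeq p i)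
    (hγ : 1 ≤ γ) (hoff : M.IsOfflineApprox f γ off) (hε : 0 < ε)
    (hO : M.IsOpt f O) (hk : M.IsRank k)
    (hα : α = ε * f O / (2 * k)) (hm : m = bufferSize d k ε)
    (hstream : ∀ i x, x ∈ stream i) (hd : 1 ≤ d) {c : ℝ} (hc : gammaSeq p d ≤ c) :
    (1 - ε) * f O ≤ (c + γ) * expect (M.output f pick off stream α β m d) f := by
  have h1 := le_expect_pass hf h0 hp hp1 hβ hγ hoff hε hO hk hα hm hstream hd le_rfl
  obtain ⟨h2, h3⟩ := max_le_expect_output (M := M) (pick := pick) (off := off) (stream := stream)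
    (α := α) (β := β) (m := m) h0 d
  have n1 := expect_nonneg (M.solS f pick off stream α β m d) h0
  have hγd := lt_gammaSeq p hp1 d hd
  have hp' : (0 : ℝ) ≤ p := Nat.cast_nonneg p
  have h4 := mul_le_mul hc h2 n1 (by linarith)
  have h5 := mul_le_mul_of_nonneg_left h3 (by linarith : 0 ≤ γ)
  linarith

end Matchoid

end

theorem mainTheorem4 {X ι : Type*} [Fintype X] [DecidableEq X] [Fintype ι]
    (f : Finset X → ℝ) (hf_nonneg : ∀ S, 0 ≤ f S) (hf : IsSubmodular f)
    (ε : ℝ) (hε : 0 < ε) (γoff : ℝ) (hγoff : 1 ≤ γoff)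
    (off : Finset X → PMF (Finset X)) (d : ℕ)
    (stream : ℕ → List X) (hstream : ∀ i, (stream i).Nodup ∧ ∀ x, x ∈ stream i) :
    (∀ (p : ℕ) (_ : 1 ≤ p) (M : Matchoid X ι p) (k : ℕ) (_ : M.IsRank k)
        (OPT : Finset X) (_ : M.IsOpt f OPT)
        (pick : ι → X → List X → X) (_ : M.IsArgminRule f pick)
        (_ : M.IsOfflineApprox f γoff off)
        (α : ℝ) (_ : α = ε * f OPT / (2 * k)) (m : ℕ) (_ : m = bufferSize d k ε),
      (∀ S ∈ (M.output f pick off stream α (betaSeq p) m d).support, M.Indep S) ∧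
      (∀ i : ℕ, 1 ≤ i → i ≤ d →
        (1 - ε) * f OPT ≤
          (p + 1 + 4 * p / i) * expect (M.solS f pick off stream α (betaSeq p) m i) f
            + γoff * expect (M.solS' f pick off stream α (betaSeq p) m i) f) ∧
      (4 * p / ε ≤ d →
        (1 - ε) * f OPT ≤
          (p + 1 + γoff + ε) * expect (M.output f pick off stream α (betaSeq p) m d) f)) ∧
    (∀ (N : Matroid X) (_ : N.E = Set.univ) (k : ℕ) (_ : (Matchoid.ofMatroid N).IsRank k)
        (OPT : Finset X) (_ : (Matchoid.ofMatroid N).IsOpt f OPT)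
        (pick : Unit → X → List X → X) (_ : (Matchoid.ofMatroid N).IsArgminRule f pick)
        (_ : (Matchoid.ofMatroid N).IsOfflineApprox f γoff off)
        (α : ℝ) (_ : α = ε * f OPT / (2 * k)) (m : ℕ) (_ : m = bufferSize d k ε),
      (∀ S ∈ ((Matchoid.ofMatroid N).output f pick off stream α (fun i => 1 / i) m d).support,
        (Matchoid.ofMatroid N).Indep S) ∧
      (2 / ε ≤ d →
        (1 - ε) * f OPT ≤ (2 + γoff + ε) *
          expect ((Matchoid.ofMatroid N).output f pick off stream α (fun i => 1 / i) m d) f)) := by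
  have hst : ∀ i x, x ∈ stream i := fun i => (hstream i).2
  -- A positive lower bound on d rules out d = 0, and makes the excess c/d of the factor at most ε.
  have hpos : ∀ c : ℝ, 0 < c → c / ε ≤ d → 1 ≤ d ∧ c / d ≤ ε := by
    intro c hc h
    have hd : (0 : ℝ) < d := (div_pos hc hε).trans_le h
    refine ⟨by exact_mod_cast hd, ?_⟩
    rw [div_le_iff₀ hε] at h
    rw [div_le_iff₀ hd]
    linarith
  constructor
  · intro p hp1 M k hk OPT hO pick hpick hoff α hα m hm
    have hp' : (1 : ℝ) ≤ p := by exact_mod_cast hp1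
    refine ⟨fun S hS => Matchoid.indep_of_mem_support_output hpick
      (fun B T hT => ((hoff B).1 T hT).2) d hS, fun i hi hid => ?_, fun h => ?_⟩
    · have h1 := Matchoid.le_expect_pass hf hf_nonneg hpick hp1 (fun _ _ => rfl) hγoff hoff hε hO
        hk hα hm hst hi hid
      have h2 := mul_le_mul_of_nonneg_right (gammaSeq_le p hp1 i hi)
        (expect_nonneg (M.solS f pick off stream α (betaSeq p) m i) hf_nonneg)
      linarith
    · obtain ⟨hd, hdε⟩ := hpos (4 * p) (by linarith) h
      have h1 := Matchoid.le_expect_output hf hf_nonneg hpick hp1 (fun _ _ => rfl) hγoff hoff hε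
        hO hk hα hm hst hd (c := p + 1 + ε) (by linarith [gammaSeq_le p hp1 d hd])
      rwa [add_right_comm] at h1
  · intro N _ k hk OPT hO pick hpick hoff α hα m hm
    refine ⟨fun S hS => Matchoid.indep_of_mem_support_output hpick
      (fun B T hT => ((hoff B).1 T hT).2) d hS, fun h => ?_⟩
    obtain ⟨hd, hdε⟩ := hpos 2 (by norm_num) h
    -- For p = 1 the general parameters are 1/i for i ≥ 1. The two sequences differ at index 0,
    -- which no pass uses.
    have h1 := Matchoid.le_expect_output hf hf_nonneg hpick le_rfl
      (fun i hi => (betaSeq_one i hi).symm) hγoff hoff hε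
      hO hk hα hm hst hd (c := 2 + ε) (by rw [gammaSeq_one d hd]; linarith)
    rwa [add_right_comm] at h1
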